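/- Let $n\ge 2$ and let $O_n$ be the Cuntz algebra, the universal $C^*$-algebra generated by isometries $S_1,\dots,S_n$ with $\sum_i S_iS_i^*=1$. Let $\gamma$ be the gauge action of the circle, $\gamma_z(S_i)=zS_i$, let $F=O_n^{\gamma}$ be its fixed point algebra, and let $\Phi:O_n\to F$, $\Phi(a)=\frac1{2\pi}\int_0^{2\pi}\gamma_{e^{i\theta}}(a)\,d\theta$, be the canonical expectation. Let $X_c=\operatorname{span}\{S_\mu S_\nu^*:\mu,\nu \text{ finite words in }\{1,\dots,n\}\}\subset O_n$ with the $F$-valued inner product $(x|y)_R=\Phi(x^*y)$. Then $F$ has exactly one faithful normalised trace (faithful tracial state) $\tau$. Let $\mathcal H=L^2(O_n)$ be the completion of $O_n$ for the inner product $\langle a,b\rangle=(\tau\circ\Phi)(a^*b)$. For $x,y\in X_c$ let $\Theta_{x,y}$ be the rank one endomorphism $\Theta_{x,y}z=x\,(y|z)_R=x\,\Phi(y^*z)$, extended to a bounded operator on $\mathcal H$; let $\mathrm{End}^{00}_F(X_c)$ be the linear span of all $\Theta_{x,y}$, and let $$\mathcal N=(\mathrm{End}^{00}_F(X_c))''$$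 where the commutants are taken in $\mathcal B(\mathcal H)$. Let $\mathcal D$, the generator of the gauge action, be the closure in $\mathcal H$ of the operator with domain $X_c$ given by $\mathcal D(S_\mu S_\nu^*)=(|\mu|-|\nu|)S_\mu S_\nu^*$. Then: 1. $\mathcal N$ is semifinite. 2. There is a faithful normal semifinite trace $\tilde\tau:\mathcal N_+\to[0,\infty]$ such that for all $x,y\in X_c$ the operator $\Theta_{x,y}$ lies in the domain of definition $\operatorname{span}\{T\in\mathcal N_+:\tilde\tau(T)<\infty\}$ of $\tilde\tau$ and, for the linear extension of $\tilde\tau$ to this domain, $$\tilde\tau(\Theta_{x,y})=(\tau\circ\Phi)(y^*x).$$ 3. $\mathcal D$ is affiliated to $\mathcal N$, that is, $\mathcal D$ is closed and densely defined and $u\mathcal D u^*=\mathcal D$ for every unitary $u\in\mathcal N'$. -/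

import Mathlib

open scoped ENNReal NNReal ComplexOrder InnerProductSpace
open MeasureTheory

/-! ## Von Neumann algebras -/

namespace VonNeumannAlgebra

variable {H : Type*} [NormedAddCommGroup H] [InnerProductSpace ℂ H] [CompleteSpace H]

/-- The double commutant of a star-closed set of operators. -/
noncomputable def bicommutant (s : Set (H →L[ℂ] H)) (hs : ∀ T ∈ s, star T ∈ s) :
    VonNeumannAlgebra H where
  carrier := s.centralizer.centralizer
  mul_mem' := Set.mul_mem_centralizer
  one_mem' := Set.one_mem_centralizer
  add_mem' := Set.add_mem_centralizer
  zero_mem' := Set.zero_mem_centralizer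
  algebraMap_mem' c T _ := (Algebra.commutes c T).symm
  star_mem' := Set.star_mem_centralizer' fun _ => Set.star_mem_centralizer' hs
  centralizer_centralizer' := by simp

/-- A projection of `N` is finite if it is not Murray-von Neumann equivalent, in `N`, to a proper
subprojection of itself. -/
structure IsFiniteProjection (N : VonNeumannAlgebra H) (p : H →L[ℂ] H) : Prop where
  mem : p ∈ N
  isStarProjection : IsStarProjection p
  finite : ∀ v ∈ N, star v * v = p → v * star v ≤ p → v * star v = p

/-- `N` is semifinite if every nonzero central projection majorizes a nonzero finite one. -/
def IsSemifinite (N : VonNeumannAlgebra H) : Prop :=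
  ∀ z ∈ N, z ∈ N.commutant → IsStarProjection z → z ≠ 0 →
    ∃ p, N.IsFiniteProjection p ∧ p ≠ 0 ∧ p ≤ z

/-- A faithful normal semifinite trace `N₊ → [0, ∞]`. Only the values of `τ` on the positive cone
of `N` are relevant. -/
structure IsFNSTrace (N : VonNeumannAlgebra H) (τ : (H →L[ℂ] H) → ℝ≥0∞) : Prop where
  map_add : ∀ S ∈ N, ∀ T ∈ N, 0 ≤ S → 0 ≤ T → τ (S + T) = τ S + τ T
  map_smul : ∀ c : ℝ≥0, ∀ T ∈ N, 0 ≤ T → τ ((c : ℂ) • T) = c * τ T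
  tracial : ∀ T ∈ N, τ (star T * T) = τ (T * star T)
  faithful : ∀ T ∈ N, 0 ≤ T → τ T = 0 → T = 0
  /-- `τ` preserves suprema of bounded increasing nets of positive elements. -/
  normal : ∀ (s : Set (H →L[ℂ] H)) (T : H →L[ℂ] H), s.Nonempty → DirectedOn (· ≤ ·) s →
    (∀ S ∈ s, S ∈ N ∧ 0 ≤ S) → IsLUB s T → τ T = ⨆ S ∈ s, τ S
  semifinite : ∀ T ∈ N, 0 ≤ T → T ≠ 0 → ∃ S ∈ N, 0 ≤ S ∧ S ≤ T ∧ S ≠ 0 ∧ τ S < ∞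

/-- The domain of definition of a trace: the span of the positive elements of finite trace. -/
def traceDomain (N : VonNeumannAlgebra H) (τ : (H →L[ℂ] H) → ℝ≥0∞) : Submodule ℂ (H →L[ℂ] H) :=
  Submodule.span ℂ {T | T ∈ N ∧ 0 ≤ T ∧ τ T < ∞}

/-- A closed densely defined operator `D` is affiliated to `N` if `u D = D u` for every unitary `u`
in the commutant of `N`. (As this is required also of `u⁻¹`, the inclusion `u D ⊆ D u` suffices.) -/
structure IsAffiliated (N : VonNeumannAlgebra H) (D : H →ₗ.[ℂ] H) : Prop where
  isClosed : D.IsClosed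
  dense_domain : Dense (D.domain : Set H)
  commute : ∀ u ∈ N.commutant, u ∈ unitary (H →L[ℂ] H) → ∀ ξ : D.domain,
    ∃ h : u (ξ : H) ∈ D.domain, D ⟨u (ξ : H), h⟩ = u (D ξ)

end VonNeumannAlgebra


/-! ## The Cuntz algebra -/

/-- The Hilbert space `ℓ²(ℕ)`. -/
abbrev SeqHilbert : Type := lp (fun _ : ℕ => ℂ) 2

instance : Nontrivial SeqHilbert :=
  ⟨lp.single 2 (0 : ℕ) (1 : ℂ), 0, fun h => by
    have := congrArg (fun x : SeqHilbert => x 0) h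
    simp at this⟩

/-- A Cuntz family on `ℓ²(ℕ)`: isometries `S₁, …, Sₙ` with `∑ Sᵢ Sᵢ* = 1`. -/
def CuntzFamily (n : ℕ) : Type :=
  {S : Fin n → (SeqHilbert →L[ℂ] SeqHilbert) //
    (∀ i, star (S i) * S i = 1) ∧ ∑ i, S i * star (S i) = 1}

/-- The `ℓ^∞`-product of copies of `B(ℓ²(ℕ))`, one for each Cuntz family. -/
abbrev CuntzAmbient (n : ℕ) : Type :=
  lp (fun _ : CuntzFamily n => SeqHilbert →L[ℂ] SeqHilbert) ∞

noncomputable instance (n : ℕ) : CStarAlgebra (CuntzAmbient n) where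

lemma CuntzFamily.norm_le_one {n : ℕ} (r : CuntzFamily n) (i : Fin n) : ‖r.1 i‖ ≤ 1 := by
  have h := CStarRing.norm_star_mul_self (x := r.1 i)
  rw [r.2.1 i, norm_one] at h
  nlinarith [norm_nonneg (r.1 i)]

/-- The universal generator: in the coordinate of the Cuntz family `r` it is `r i`. -/
def cuntzAmbientGen (n : ℕ) (i : Fin n) : CuntzAmbient n :=
  ⟨fun r => r.1 i, memℓp_infty ⟨1, by rintro _ ⟨r, rfl⟩; exact r.norm_le_one i⟩⟩

/-- The closed unital star subalgebra generated by the universal generators. -/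
noncomputable def cuntzSubalgebra (n : ℕ) : StarSubalgebra ℂ (CuntzAmbient n) :=
  (StarAlgebra.adjoin ℂ (Set.range (cuntzAmbientGen n))).topologicalClosure

/-- The Cuntz algebra `O_n`, that is, the universal C⋆-algebra generated by isometries
`S₁, …, Sₙ` with `∑ Sᵢ Sᵢ* = 1`. The norm of a star polynomial in the generators is its supremum
over all Cuntz families on `ℓ²(ℕ)`; these suffice because a representation of the relations is a
direct sum of cyclic ones, and cyclic ones live on separable Hilbert spaces. -/
def CuntzAlgebra (n : ℕ) : Type := cuntzSubalgebra n

namespace CuntzAlgebra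

instance isClosed_cuntzSubalgebra (n : ℕ) : IsClosed (cuntzSubalgebra n : Set (CuntzAmbient n)) :=
  StarSubalgebra.isClosed_topologicalClosure _

noncomputable instance (n : ℕ) : CStarAlgebra (CuntzAlgebra n) :=
  inferInstanceAs (CStarAlgebra (cuntzSubalgebra n))

/-- The usual order of a C⋆-algebra: `a ≤ b` if and only if `b - a` is positive. -/
noncomputable instance (n : ℕ) : PartialOrder (CuntzAlgebra n) := CStarAlgebra.spectralOrder _

instance (n : ℕ) : StarOrderedRing (CuntzAlgebra n) := CStarAlgebra.spectralOrderedRing _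

/-- The inclusion of the Cuntz algebra in the `ℓ^∞`-product. -/
noncomputable def incl (n : ℕ) : CuntzAlgebra n →⋆ₐ[ℂ] CuntzAmbient n := (cuntzSubalgebra n).subtype

/-- The generating isometries `S₁, …, Sₙ` of `O_n`. -/
noncomputable def gen {n : ℕ} (i : Fin n) : CuntzAlgebra n :=
  ⟨cuntzAmbientGen n i, (StarSubalgebra.le_topologicalClosure _)
    (StarAlgebra.subset_adjoin ℂ _ ⟨i, rfl⟩)⟩

lemma star_gen_mul_gen {n : ℕ} (i : Fin n) : star (gen i) * gen i = (1 : CuntzAlgebra n) := by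
  apply Subtype.ext
  apply Subtype.ext
  funext r
  exact r.2.1 i

lemma sum_gen_mul_star {n : ℕ} : ∑ i, gen i * star (gen i) = (1 : CuntzAlgebra n) := by
  have h : Function.Injective (incl n) := Subtype.val_injective
  apply h
  apply Subtype.ext
  funext r
  rw [map_sum, map_one]
  have : ((∑ i, incl n (gen i * star (gen i)) : CuntzAmbient n) : ∀ _ : CuntzFamily n, _) r
      = ∑ i, r.1 i * star (r.1 i) := by
    rw [lp.coeFn_sum, Finset.sum_apply]
    rfl
  rw [this, r.2.2]
  rfl

/-! ### The gauge action -/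

/-- The Cuntz family `z S₁, …, z Sₙ`. -/
noncomputable def twist {n : ℕ} (z : Circle) (r : CuntzFamily n) : CuntzFamily n :=
  ⟨fun i => (z : ℂ) • r.1 i, by
    have hz : (starRingEnd ℂ) (z : ℂ) * (z : ℂ) = 1 := by
      rw [mul_comm, Complex.mul_conj, Circle.normSq_coe, Complex.ofReal_one]
    constructor
    · intro i
      rw [star_smul, smul_mul_smul_comm, r.2.1 i]
      simp [hz]
    · refine Eq.trans (Finset.sum_congr rfl fun i _ => ?_) r.2.2
      rw [star_smul, smul_mul_smul_comm, mul_comm]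
      simp [hz]⟩

/-- The gauge action on the product: relabel the coordinates along `r ↦ z r`. -/
noncomputable def ambientGauge (n : ℕ) (z : Circle) : CuntzAmbient n →⋆ₐ[ℂ] CuntzAmbient n where
  toFun a := ⟨fun r => a (twist z r), memℓp_infty ⟨‖a‖, by
    rintro _ ⟨r, rfl⟩; exact lp.norm_apply_le_norm (by simp) a _⟩⟩
  map_one' := rfl
  map_mul' _ _ := rfl
  map_zero' := rfl
  map_add' _ _ := rfl
  commutes' _ := rfl
  map_star' _ := rfl

lemma ambientGauge_gen (n : ℕ) (z : Circle) (i : Fin n) :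
    ambientGauge n z (cuntzAmbientGen n i) = (z : ℂ) • cuntzAmbientGen n i := rfl

lemma ambientGauge_mem {n : ℕ} (z : Circle) {a : CuntzAmbient n} (ha : a ∈ cuntzSubalgebra n) :
    ambientGauge n z a ∈ cuntzSubalgebra n := by
  have hc : Continuous (ambientGauge n z) := by
    have := AddMonoidHomClass.continuous_of_bound (ambientGauge n z) 1 (fun a => by simpa using NonUnitalStarAlgHom.norm_apply_le (ambientGauge n z) a)
    exact this
  have h1 : StarAlgebra.adjoin ℂ (Set.range (cuntzAmbientGen n)) ≤
      (cuntzSubalgebra n).comap (ambientGauge n z) := by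
    rw [StarAlgebra.adjoin_le_iff]
    rintro _ ⟨i, rfl⟩
    change ambientGauge n z _ ∈ cuntzSubalgebra n
    rw [ambientGauge_gen]
    exact (cuntzSubalgebra n).smul_mem (gen i).2 _
  have h2 : IsClosed (((cuntzSubalgebra n).comap (ambientGauge n z)) : Set (CuntzAmbient n)) :=
    (isClosed_cuntzSubalgebra n).preimage hc
  exact StarSubalgebra.topologicalClosure_minimal h1 h2 ha

/-- The gauge automorphism `γ_z` of `O_n`, determined by `γ_z(Sᵢ) = z Sᵢ`. -/
noncomputable def gauge {n : ℕ} (z : Circle) : CuntzAlgebra n →⋆ₐ[ℂ] CuntzAlgebra n :=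
  StarAlgHom.codRestrict ((ambientGauge n z).comp (incl n)) (cuntzSubalgebra n)
    fun a => ambientGauge_mem z a.2

lemma gauge_gen {n : ℕ} (z : Circle) (i : Fin n) :
    gauge z (gen i) = (z : ℂ) • (gen i : CuntzAlgebra n) := rfl

lemma gauge_mul {n : ℕ} (z w : Circle) (a : CuntzAlgebra n) :
    gauge (z * w) a = gauge z (gauge w a) := by
  apply Subtype.ext
  apply Subtype.ext
  funext r
  change (a.1 : ∀ _ : CuntzFamily n, _) (twist (z * w) r) = a.1 (twist w (twist z r))
  have h : twist (z * w) r = twist w (twist z r) := by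
    apply Subtype.ext
    funext i
    change ((z * w : Circle) : ℂ) • r.1 i = (w : ℂ) • (z : ℂ) • r.1 i
    rw [smul_smul, mul_comm (w : ℂ), Circle.coe_mul]
  rw [h]

/-- `γ_z` as a continuous linear map. -/
noncomputable def gaugeL {n : ℕ} (z : Circle) : CuntzAlgebra n →L[ℂ] CuntzAlgebra n :=
  (gauge z : CuntzAlgebra n →⋆ₐ[ℂ] CuntzAlgebra n).toAlgHom.toLinearMap.mkContinuous 1 fun a => by
    rw [one_mul]; exact NonUnitalStarAlgHom.norm_apply_le (gauge z) a

lemma gaugeL_apply {n : ℕ} (z : Circle) (a : CuntzAlgebra n) : gaugeL z a = gauge z a := rfl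

lemma continuous_ambientGauge {n : ℕ} {b : CuntzAmbient n}
    (hb : b ∈ StarAlgebra.adjoin ℂ (Set.range (cuntzAmbientGen n))) :
    Continuous fun z : Circle => ambientGauge n z b := by
  induction hb using StarAlgebra.adjoin_induction with
  | mem x hx =>
    obtain ⟨i, rfl⟩ := hx
    simp only [ambientGauge_gen]
    exact (continuous_subtype_val : Continuous fun z : Circle => (z : ℂ)).smul continuous_const
  | algebraMap r => simp only [AlgHomClass.commutes]; exact continuous_const
  | add x y _ _ hx hy => simp only [map_add]; exact hx.add hy
  | mul x y _ _ hx hy => simp only [map_mul]; exact hx.mul hy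
  | star x _ hx => simp only [map_star]; exact hx.star

/-- The gauge action is strongly continuous. -/
lemma continuous_gauge {n : ℕ} (a : CuntzAlgebra n) : Continuous fun z : Circle => gauge z a := by
  have key : Continuous fun z : Circle => ambientGauge n z a.1 := by
    refine continuous_of_uniform_approx_of_continuous fun u hu => ?_
    obtain ⟨ε, hε, hu⟩ := Metric.mem_uniformity_dist.1 hu
    obtain ⟨b, hb, hab⟩ := Metric.mem_closure_iff.1 (show a.1 ∈ closure
      (StarAlgebra.adjoin ℂ (Set.range (cuntzAmbientGen n)) : Set (CuntzAmbient n)) from a.2) ε hε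
    refine ⟨fun z => ambientGauge n z b, continuous_ambientGauge hb, fun z => hu ?_⟩
    rw [dist_eq_norm] at hab ⊢
    rw [← map_sub]
    exact (NonUnitalStarAlgHom.norm_apply_le (ambientGauge n z) _).trans_lt hab
  exact Continuous.subtype_mk key _

/-! ### The conditional expectation -/

/-- The fixed point algebra `F` of the gauge action. -/
noncomputable def core (n : ℕ) : StarSubalgebra ℂ (CuntzAlgebra n) where
  carrier := {a | ∀ z : Circle, gauge z a = a}
  mul_mem' ha hb z := by rw [map_mul, ha z, hb z]
  add_mem' ha hb z := by rw [map_add, ha z, hb z]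
  algebraMap_mem' c z := AlgHomClass.commutes (gauge z) c
  star_mem' ha z := by rw [map_star, ha z]

/-- `Φ(a) = (2π)⁻¹ ∫₀^{2π} γ_{exp(iθ)}(a) dθ`. -/
noncomputable def gaugeMean {n : ℕ} (a : CuntzAlgebra n) : CuntzAlgebra n :=
  (2 * Real.pi)⁻¹ • ∫ θ in (0 : ℝ)..(2 * Real.pi), gauge (Circle.exp θ) a

lemma continuous_gauge_exp {n : ℕ} (a : CuntzAlgebra n) :
    Continuous fun θ : ℝ => gauge (Circle.exp θ) a :=
  (continuous_gauge a).comp Circle.exp.continuous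

lemma gaugeMean_mem {n : ℕ} (a : CuntzAlgebra n) : gaugeMean a ∈ core n := by
  intro z
  obtain ⟨t, rfl⟩ : ∃ t : ℝ, Circle.exp t = z := ⟨Complex.arg z, Circle.exp_arg z⟩
  have hint : IntervalIntegrable (fun θ : ℝ => gauge (Circle.exp θ) a) volume 0 (2 * Real.pi) :=
    (continuous_gauge_exp a).intervalIntegrable _ _
  have hper : Function.Periodic (fun θ : ℝ => gauge (Circle.exp θ) a) (2 * Real.pi) := fun θ => by
    change gauge (Circle.exp (θ + 2 * Real.pi)) a = _
    rw [Circle.periodic_exp θ]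
  rw [← gaugeL_apply, gaugeMean, ← Complex.coe_smul, map_smul,
    ← ContinuousLinearMap.intervalIntegral_comp_comm _ hint]
  congr 1
  simp only [gaugeL_apply, ← gauge_mul, ← Circle.exp_add]
  simp only [add_comm t]
  rw [intervalIntegral.integral_comp_add_right (fun θ : ℝ => gauge (Circle.exp θ) a) t]
  rw [add_comm (2 * Real.pi) t]
  have := hper.intervalIntegral_add_eq (0 + t) 0
  simpa only [zero_add] using this

lemma gaugeMean_nonneg {n : ℕ} {a : CuntzAlgebra n} (ha : 0 ≤ a) : 0 ≤ gaugeMean a := by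
  have h : ∀ θ : ℝ, 0 ≤ gauge (Circle.exp θ) a := fun θ => map_nonneg (gauge (Circle.exp θ)) ha
  rw [gaugeMean, intervalIntegral.integral_of_le Real.two_pi_pos.le]
  exact smul_nonneg (inv_nonneg.2 Real.two_pi_pos.le) (integral_nonneg h)

lemma gaugeMean_add {n : ℕ} (a b : CuntzAlgebra n) :
    gaugeMean (a + b) = gaugeMean a + gaugeMean b := by
  simp only [gaugeMean, map_add]
  rw [intervalIntegral.integral_add ((continuous_gauge_exp a).intervalIntegrable _ _)
    ((continuous_gauge_exp b).intervalIntegrable _ _), smul_add]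

lemma gaugeMean_smul {n : ℕ} (c : ℂ) (a : CuntzAlgebra n) :
    gaugeMean (c • a) = c • gaugeMean a := by
  simp only [gaugeMean, map_smul]
  rw [intervalIntegral.integral_smul, smul_comm]

lemma gaugeMean_mul {n : ℕ} {f : CuntzAlgebra n} (hf : f ∈ core n) (a : CuntzAlgebra n) :
    gaugeMean (f * a) = f * gaugeMean a := by
  have h : ∀ θ : ℝ, gauge (Circle.exp θ) (f * a) =
      ContinuousLinearMap.mul ℂ _ f (gauge (Circle.exp θ) a) := fun θ => by
    rw [map_mul, hf, ContinuousLinearMap.mul_apply']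
  simp only [gaugeMean, h]
  rw [ContinuousLinearMap.intervalIntegral_comp_comm _
    ((continuous_gauge_exp a).intervalIntegrable _ _), ContinuousLinearMap.mul_apply',
    mul_smul_comm]

/-- The expectation `Φ : O_n → F`, as a positive linear map. -/
noncomputable def expectation (n : ℕ) : CuntzAlgebra n →ₚ[ℂ] core n :=
  PositiveLinearMap.mk₀
    { toFun := fun a => ⟨gaugeMean a, gaugeMean_mem a⟩
      map_add' := fun a b => Subtype.ext (gaugeMean_add a b)
      map_smul' := fun c a => Subtype.ext (gaugeMean_smul c a) }
    fun _ ha => gaugeMean_nonneg ha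

/-- `τ` is a faithful normalised trace on the fixed point algebra `F`. -/
structure IsFaithfulNormalizedTrace {n : ℕ} (τ : core n →ₚ[ℂ] ℂ) : Prop where
  map_one : τ 1 = 1
  map_mul_comm : ∀ a b, τ (a * b) = τ (b * a)
  faithful : ∀ a, τ (star a * a) = 0 → a = 0

/-- The state `τ ∘ Φ` on `O_n`. -/
noncomputable def gaugeState {n : ℕ} (τ : core n →ₚ[ℂ] ℂ) : CuntzAlgebra n →ₚ[ℂ] ℂ :=
  τ.comp (expectation n)

/-- The element `S_μ S_ν*` for two words `μ`, `ν` in `{1, …, n}`. -/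
noncomputable def monomial {n : ℕ} (μ ν : List (Fin n)) : CuntzAlgebra n :=
  (μ.map gen).prod * star (ν.map gen).prod

/-- `O_{nc}`, the linear span of the elements `S_μ S_ν*`. As a right module over `F` (or `F_c`), with
the inner product `(a|b)_R = Φ(a* b)`, it is `X_c`. -/
noncomputable def algSpan (n : ℕ) : Submodule ℂ (CuntzAlgebra n) :=
  Submodule.span ℂ {a | ∃ μ ν : List (Fin n), a = monomial μ ν}

section Hilbert

variable {n : ℕ} (τ : core n →ₚ[ℂ] ℂ)

/-- The Hilbert space `L²(O_n)`: the completion of `O_n` for `⟨a, b⟩ = (τ ∘ Φ)(a* b)`. -/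
abbrev L2 : Type := (gaugeState τ).GNS

/-- The canonical linear map of `O_n` into `L²(O_n)`. -/
noncomputable def toL2 : CuntzAlgebra n →ₗ[ℂ] L2 τ :=
  (UniformSpace.Completion.toComplL (𝕜 := ℂ) (E := (gaugeState τ).PreGNS)).toLinearMap ∘ₗ
    (gaugeState τ).toPreGNS.toLinearMap

lemma inner_toL2 (a b : CuntzAlgebra n) :
    ⟪toL2 τ a, toL2 τ b⟫_ℂ = gaugeState τ (star a * b) :=
  UniformSpace.Completion.inner_coe _ _

/-- Left multiplication of `O_n` on `L²(O_n)`. -/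
noncomputable def leftMul : CuntzAlgebra n →⋆ₐ[ℂ] (L2 τ →L[ℂ] L2 τ) := (gaugeState τ).gnsStarAlgHom

lemma leftMul_toL2 (a b : CuntzAlgebra n) : leftMul τ a (toL2 τ b) = toL2 τ (a * b) :=
  PositiveLinearMap.gnsNonUnitalStarAlgHom_apply_coe (gaugeState τ)

/-- The closure of `F` in `L²(O_n)`. -/
noncomputable def coreL2 : Submodule ℂ (L2 τ) :=
  ((core n).toSubalgebra.toSubmodule.map (toL2 τ)).topologicalClosure

instance : CompleteSpace (coreL2 τ) :=
  (Submodule.isClosed_topologicalClosure _).completeSpace_coe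

lemma starProjection_toL2 (a : CuntzAlgebra n) :
    (coreL2 τ).starProjection (toL2 τ a) = toL2 τ (expectation n a : CuntzAlgebra n) := by
  refine Submodule.eq_starProjection_of_mem_orthogonal
    (Submodule.le_topologicalClosure _ ⟨_, (expectation n a).2, rfl⟩) ?_
  rw [coreL2, Submodule.orthogonal_closure, Submodule.mem_orthogonal]
  rintro _ ⟨f, hf, rfl⟩
  have hf' : star f ∈ core n := (core n).star_mem' hf
  have hidem : gaugeMean (gaugeMean a) = gaugeMean a := by
    have h := gaugeMean_mul (gaugeMean_mem a) 1
    have h1 : gaugeMean (1 : CuntzAlgebra n) = 1 := by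
      simp only [gaugeMean, map_one, intervalIntegral.integral_const, sub_zero]
      rw [smul_smul, inv_mul_cancel₀ Real.two_pi_pos.ne', one_smul]
    rwa [h1, mul_one] at h
  rw [← map_sub, inner_toL2]
  have h0 : expectation n (star f * (a - (expectation n a : CuntzAlgebra n))) = 0 := by
    apply Subtype.ext
    change gaugeMean (star f * (a - gaugeMean a)) = 0
    rw [gaugeMean_mul hf', sub_eq_add_neg, ← neg_one_smul ℂ (gaugeMean a), gaugeMean_add,
      gaugeMean_smul, hidem]
    simp
  change τ (expectation n _) = 0
  rw [h0, map_zero]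

/-- The rank one endomorphism `Θ_{x,y} z = x (y|z)_R = x Φ(y* z)`, as a bounded operator on
`L²(O_n)`: the map `z ↦ Φ(z)` extends to the projection on the closure of `F`. -/
noncomputable def rankOneEnd (x y : CuntzAlgebra n) : L2 τ →L[ℂ] L2 τ :=
  leftMul τ x ∘L (coreL2 τ).starProjection ∘L leftMul τ (star y)

/-- The defining formula of `Θ_{x,y}` on the dense subspace `O_n` of `L²(O_n)`. -/
lemma rankOneEnd_toL2 (x y z : CuntzAlgebra n) :
    rankOneEnd τ x y (toL2 τ z) = toL2 τ (x * (expectation n (star y * z) : CuntzAlgebra n)) := by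
  change leftMul τ x ((coreL2 τ).starProjection (leftMul τ (star y) (toL2 τ z))) = _
  rw [leftMul_toL2, starProjection_toL2, leftMul_toL2]

lemma star_rankOneEnd (x y : CuntzAlgebra n) :
    star (rankOneEnd τ x y) = rankOneEnd τ y x := by
  change star (leftMul τ x * ((coreL2 τ).starProjection * leftMul τ (star y))) =
    leftMul τ y * ((coreL2 τ).starProjection * leftMul τ (star x))
  rw [star_mul, star_mul, (isSelfAdjoint_starProjection (coreL2 τ)).star_eq, ← map_star,
    ← map_star, star_star, mul_assoc]

/-- `End⁰⁰_F(X_c)`: the finite rank endomorphisms of `X_c`, acting on `L²(O_n)`. -/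
noncomputable def finiteRankEnd : Submodule ℂ (L2 τ →L[ℂ] L2 τ) :=
  Submodule.span ℂ {T | ∃ x ∈ algSpan n, ∃ y ∈ algSpan n, T = rankOneEnd τ x y}

lemma star_mem_finiteRankEnd {T : L2 τ →L[ℂ] L2 τ} (hT : T ∈ finiteRankEnd τ) :
    star T ∈ finiteRankEnd τ := by
  induction hT using Submodule.span_induction with
  | mem x hx =>
    obtain ⟨x, hx, y, hy, rfl⟩ := hx
    exact Submodule.subset_span ⟨y, hy, x, hx, star_rankOneEnd τ x y⟩
  | zero => simp
  | add S T _ _ hS hT => rw [star_add]; exact add_mem hS hT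
  | smul c T _ hT => rw [star_smul]; exact Submodule.smul_mem _ _ hT

/-- The von Neumann algebra `N = (End⁰⁰_F(X_c))''`. -/
noncomputable def endVN : VonNeumannAlgebra (L2 τ) :=
  VonNeumannAlgebra.bicommutant (finiteRankEnd τ) fun _ => star_mem_finiteRankEnd τ

/-- The generator of the gauge action: the closure of the operator with domain `X_c` and
`D(S_μ S_ν*) = (|μ| - |ν|) S_μ S_ν*`. -/
noncomputable def gaugeGenerator : L2 τ →ₗ.[ℂ] L2 τ :=
  (Submodule.span ℂ {p : L2 τ × L2 τ | ∃ μ ν : List (Fin n),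
    p = (toL2 τ (monomial μ ν),
      ((μ.length : ℂ) - (ν.length : ℂ)) • toL2 τ (monomial μ ν))}).topologicalClosure.toLinearPMap

end Hilbert

end CuntzAlgebra

open CuntzAlgebra

/-
The core `F` is the closure of the increasing union of the matrix algebras spanned by the
`S_μ S_ν*` with `|μ| = |ν| = k`. A normalised trace on `F` must take the value `δ_{μν} n^{-k}` at
`S_μ S_ν*`, so there is at most one. It exists because `a ↦ n⁻¹ ∑ Sᵢ* a Sᵢ` maps the `(k + 1)`-st
matrix algebra to the `k`-th, so that its iterates converge to a scalar on `F`; it is faithful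
because it is faithful on every matrix algebra, so that its GNS representation is isometric on
each of them and hence on `F`.

Over `F`, the module `X_c` has an orthogonal frame consisting of the `S_μ` and the powers of
`S₁*`. The operators `Θ_{ξ,ξ}`, with `ξ` in the frame, are pairwise orthogonal projections in
`𝒩` which sum up to `1`, and `𝒟` is diagonal with respect to them: hence `𝒟` is affiliated to
`𝒩`. The trace on `𝒩` is `T ↦ ∑ ⟨T ξ, ξ⟩`. It is tracial since the operators in `𝒩` commute with
right multiplication by `F`, and on operators `A` with this property `⟨A 1, 1⟩` inherits the
trace property of `τ`. It is finite on the `Θ_{ξ,ξ}`, which gives semifiniteness.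
-/

open Filter Topology

section WeakLimits

variable {H : Type*} [NormedAddCommGroup H] [InnerProductSpace ℂ H]

lemma inner_apply_self_mono {S T : H →L[ℂ] H} (h : S ≤ T) (v : H) :
    ⟪S v, v⟫_ℂ ≤ ⟪T v, v⟫_ℂ := by
  have hpos := ((ContinuousLinearMap.le_def S T).1 h).inner_nonneg_left v
  rwa [sub_apply, inner_sub_left, sub_nonneg] at hpos

lemma le_of_forall_inner_apply_self_le {S T : H →L[ℂ] H}
    (h : ∀ v, ⟪S v, v⟫_ℂ ≤ ⟪T v, v⟫_ℂ) : S ≤ T := by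
  rw [ContinuousLinearMap.le_def, ContinuousLinearMap.isPositive_iff_complex]
  intro v
  have hpos : 0 ≤ ⟪(T - S) v, v⟫_ℂ := by rw [sub_apply, inner_sub_left, sub_nonneg]; exact h v
  exact ⟨(Complex.eq_re_of_ofReal_le hpos).symm, hpos.1⟩

lemma inner_apply_self_nonneg {T : H →L[ℂ] H} (hT : 0 ≤ T) (v : H) : 0 ≤ ⟪T v, v⟫_ℂ := by
  simpa using inner_apply_self_mono hT v

lemma tendsto_limUnder_of_norm_le {ι : Type*} (U : Ultrafilter ι) {f : ι → ℂ} {C : ℝ}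
    (h : ∀ i, ‖f i‖ ≤ C) : Tendsto f U (𝓝 (limUnder U f)) := by
  refine tendsto_nhds_limUnder ?_
  obtain ⟨z, -, hz⟩ := (isCompact_closedBall (0 : ℂ) C).ultrafilter_le_nhds (U.map f)
    (le_principal_iff.2 (mem_map.2 (univ_mem' fun i => mem_closedBall_zero_iff.2 (h i))))
  exact ⟨z, hz⟩

variable [CompleteSpace H]

lemma exists_tendsto_inner_of_norm_le {ι : Type*} (U : Ultrafilter ι) (F : ι → H →L[ℂ] H) {C : ℝ}
    (hF : ∀ i, ‖F i‖ ≤ C) :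
    ∃ T : H →L[ℂ] H, ∀ v w, Tendsto (fun i => ⟪F i v, w⟫_ℂ) U (𝓝 ⟪T v, w⟫_ℂ) := by
  have hbound : ∀ v w i, ‖⟪F i v, w⟫_ℂ‖ ≤ C * ‖v‖ * ‖w‖ := fun v w i =>
    (norm_inner_le_norm _ _).trans
      (mul_le_mul_of_nonneg_right ((F i).le_of_opNorm_le (hF i) v) (norm_nonneg w))
  have hlim := fun v w => tendsto_limUnder_of_norm_le U (hbound v w)
  let B : H →ₗ⋆[ℂ] H →ₗ[ℂ] ℂ := LinearMap.mk₂'ₛₗ (starRingEnd ℂ) (RingHom.id ℂ)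
    (fun v w => limUnder U fun i => ⟪F i v, w⟫_ℂ)
    (fun v v' w => (((hlim v w).add (hlim v' w)).congr fun i => by
      rw [map_add, inner_add_left]).limUnder_eq)
    (fun c v w => (((hlim v w).const_mul (starRingEnd ℂ c)).congr fun i => by
      rw [map_smul, inner_smul_left]).limUnder_eq)
    (fun v w w' => (((hlim v w).add (hlim v w')).congr fun i => by
      rw [inner_add_right]).limUnder_eq)
    (fun c v w => (((hlim v w).const_mul c).congr fun i => by
      rw [inner_smul_right]).limUnder_eq)
  refine ⟨InnerProductSpace.continuousLinearMapOfBilin (B.mkContinuous₂ C fun v w =>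
    le_of_tendsto (hlim v w).norm (Eventually.of_forall (hbound v w))), fun v w => ?_⟩
  rw [InnerProductSpace.continuousLinearMapOfBilin_apply]
  exact hlim v w

-- A weak limit point of the net is an upper bound, so it dominates the supremum.
lemma ofReal_re_inner_eq_iSup_of_isLUB {s : Set (H →L[ℂ] H)} {T : H →L[ℂ] H} (hne : s.Nonempty)
    (hdir : DirectedOn (· ≤ ·) s) (hpos : ∀ S ∈ s, 0 ≤ S) (hT : IsLUB s T) (v : H) :
    ENNReal.ofReal (⟪T v, v⟫_ℂ).re = ⨆ S ∈ s, ENNReal.ofReal (⟪S v, v⟫_ℂ).re := by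
  have hmono : ∀ {S S' : H →L[ℂ] H}, S ≤ S' →
      ENNReal.ofReal (⟪S v, v⟫_ℂ).re ≤ ENNReal.ofReal (⟪S' v, v⟫_ℂ).re := fun h =>
    ENNReal.ofReal_le_ofReal (inner_apply_self_mono h v).1
  refine le_antisymm ?_ (iSup₂_le fun S hS => hmono (hT.1 hS))
  have : Nonempty s := hne.to_subtype
  have : IsDirected s (· ≤ ·) := ⟨fun a b => by
    obtain ⟨c, hc, h⟩ := hdir a a.2 b b.2
    exact ⟨⟨c, hc⟩, h⟩⟩
  let U : Ultrafilter s := Ultrafilter.of atTop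
  obtain ⟨T', hT'⟩ := exists_tendsto_inner_of_norm_le U (fun S : s => (S : H →L[ℂ] H)) fun S =>
    CStarAlgebra.norm_le_norm_of_nonneg_of_le (hpos S S.2) (hT.1 S.2)
  have hupper : T' ∈ upperBounds s := fun S hS => le_of_forall_inner_apply_self_le fun w =>
    ge_of_tendsto (hT' w w) <| by
      filter_upwards [Ultrafilter.of_le atTop (Ici_mem_atTop (⟨S, hS⟩ : s))] with S' hS'
      exact inner_apply_self_mono hS' w
  have hlim : Tendsto (fun S : s => ENNReal.ofReal (⟪(S : H →L[ℂ] H) v, v⟫_ℂ).re) U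
      (𝓝 (ENNReal.ofReal (⟪T' v, v⟫_ℂ).re)) :=
    (ENNReal.continuous_ofReal.tendsto _).comp ((Complex.continuous_re.tendsto _).comp (hT' v v))
  exact (hmono (hT.2 hupper)).trans
    (le_of_tendsto' hlim fun S => le_iSup₂_of_le (S : H →L[ℂ] H) S.2 le_rfl)

end WeakLimits

section VectorWeight

variable {H : Type*} [NormedAddCommGroup H] [InnerProductSpace ℂ H] {ι : Type*}

/-- The weight `T ↦ ∑ ⟨T ξᵢ, ξᵢ⟩` on positive operators given by a family `ξ` of vectors. Its
values at operators which are not positive are junk. -/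
noncomputable def vectorWeight (ξ : ι → H) (T : H →L[ℂ] H) : ℝ≥0∞ :=
  ∑' i, ENNReal.ofReal (⟪T (ξ i), ξ i⟫_ℂ).re

variable (ξ : ι → H)

lemma vectorWeight_add {S T : H →L[ℂ] H} (hS : 0 ≤ S) (hT : 0 ≤ T) :
    vectorWeight ξ (S + T) = vectorWeight ξ S + vectorWeight ξ T := by
  rw [vectorWeight, vectorWeight, vectorWeight, ← ENNReal.tsum_add]
  refine tsum_congr fun i => ?_
  rw [add_apply, inner_add_left, Complex.add_re,
    ENNReal.ofReal_add (inner_apply_self_nonneg hS _).1 (inner_apply_self_nonneg hT _).1]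

lemma vectorWeight_smul (c : ℝ≥0) (T : H →L[ℂ] H) :
    vectorWeight ξ ((c : ℂ) • T) = c * vectorWeight ξ T := by
  rw [vectorWeight, vectorWeight, ← ENNReal.tsum_mul_left]
  refine tsum_congr fun i => ?_
  have hre : (⟪((c : ℂ) • T) (ξ i), ξ i⟫_ℂ).re = (c : ℝ) * (⟪T (ξ i), ξ i⟫_ℂ).re := by
    simp
  rw [hre, ENNReal.ofReal_mul c.coe_nonneg, ENNReal.ofReal_coe_nnreal]

lemma vectorWeight_mono {S T : H →L[ℂ] H} (h : S ≤ T) : vectorWeight ξ S ≤ vectorWeight ξ T :=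
  ENNReal.tsum_le_tsum fun i => ENNReal.ofReal_le_ofReal (inner_apply_self_mono h (ξ i)).1

lemma inner_apply_eq_ofReal_toReal {T : H →L[ℂ] H} (hT : 0 ≤ T) (v : H) :
    ⟪v, T v⟫_ℂ = (((ENNReal.ofReal (⟪T v, v⟫_ℂ).re).toReal : ℝ) : ℂ) := by
  have hnonneg := inner_apply_self_nonneg hT v
  rw [ENNReal.toReal_ofReal hnonneg.1, ← Complex.eq_re_of_ofReal_le hnonneg]
  exact (((ContinuousLinearMap.nonneg_iff_isPositive T).1 hT).inner_left_eq_inner_right v v).symm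

lemma hasSum_inner_of_vectorWeight_lt_top {T : H →L[ℂ] H} (hT : 0 ≤ T)
    (h : vectorWeight ξ T < ∞) :
    HasSum (fun i => ⟪ξ i, T (ξ i)⟫_ℂ) ((vectorWeight ξ T).toReal : ℂ) := by
  simp only [inner_apply_eq_ofReal_toReal hT]
  rw [Complex.hasSum_ofReal, vectorWeight, ENNReal.tsum_toReal_eq fun i => ENNReal.ofReal_ne_top]
  exact (ENNReal.hasSum_toReal h.ne).summable.hasSum

lemma vectorWeight_lt_top_of_summable {T : H →L[ℂ] H} (hT : 0 ≤ T)
    (h : Summable fun i => ⟪ξ i, T (ξ i)⟫_ℂ) : vectorWeight ξ T < ∞ := by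
  simp only [inner_apply_eq_ofReal_toReal hT, Complex.summable_ofReal,
    ENNReal.toReal_ofReal (inner_apply_self_nonneg hT _).1] at h
  rw [vectorWeight, ← ENNReal.ofReal_tsum_of_nonneg
    (fun i => (inner_apply_self_nonneg hT _).1) h]
  exact ENNReal.ofReal_lt_top

lemma exists_linearMap_hasSum_inner [CompleteSpace H] (N : VonNeumannAlgebra H) :
    ∃ t : N.traceDomain (vectorWeight ξ) →ₗ[ℂ] ℂ, ∀ T : N.traceDomain (vectorWeight ξ),
      HasSum (fun i => ⟪ξ i, (T : H →L[ℂ] H) (ξ i)⟫_ℂ) (t T) := by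
  have hsum : ∀ T ∈ N.traceDomain (vectorWeight ξ), Summable fun i => ⟪ξ i, T (ξ i)⟫_ℂ := by
    intro T hT
    induction hT using Submodule.span_induction with
    | mem T hT => exact (hasSum_inner_of_vectorWeight_lt_top ξ hT.2.1 hT.2.2).summable
    | zero => simpa only [zero_apply, inner_zero_right] using summable_zero
    | add S T _ _ hS hT => simpa only [add_apply, inner_add_right] using hS.add hT
    | smul c T _ hT => simpa only [smul_apply, inner_smul_right] using hT.mul_left c
  exact ⟨{
    toFun := fun T : N.traceDomain (vectorWeight ξ) => ∑' i, ⟪ξ i, (T : H →L[ℂ] H) (ξ i)⟫_ℂ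
    map_add' := fun S T => by simp [(hsum S S.2).tsum_add (hsum T T.2)]
    map_smul' := fun c T => by simp [tsum_mul_left] },
    fun T => (hsum T T.2).hasSum⟩

variable [CompleteSpace H]

lemma vectorWeight_star_mul_self (T : H →L[ℂ] H) :
    vectorWeight ξ (star T * T) = ∑' i, ENNReal.ofReal (‖T (ξ i)‖ ^ 2) := by
  refine tsum_congr fun i => ?_
  rw [mul_apply_eq_comp, ContinuousLinearMap.star_eq_adjoint,
    ContinuousLinearMap.adjoint_inner_left, inner_self_eq_norm_sq_to_K]
  norm_cast

lemma apply_eq_zero_of_vectorWeight_eq_zero {T : H →L[ℂ] H} (hT : 0 ≤ T)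
    (h : vectorWeight ξ T = 0) (i : ι) : T (ξ i) = 0 := by
  have hsqrt : CFC.sqrt T * CFC.sqrt T = T := CFC.sqrt_mul_sqrt_self T hT
  have hstar : star (CFC.sqrt T) = CFC.sqrt T := (CFC.sqrt_nonneg T).isSelfAdjoint.star_eq
  have hzero : ∑' i, ENNReal.ofReal (‖CFC.sqrt T (ξ i)‖ ^ 2) = 0 := by
    rw [← vectorWeight_star_mul_self, hstar, hsqrt, h]
  have hnorm := ENNReal.ofReal_eq_zero.1 (ENNReal.tsum_eq_zero.1 hzero i)
  have hsqrt_apply : CFC.sqrt T (ξ i) = 0 := by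
    rw [← norm_eq_zero]
    exact pow_eq_zero_iff two_ne_zero |>.1 (hnorm.antisymm (sq_nonneg _))
  rw [← hsqrt, mul_apply_eq_comp, hsqrt_apply, map_zero]

lemma vectorWeight_eq_iSup_of_isLUB {s : Set (H →L[ℂ] H)} {T : H →L[ℂ] H} (hne : s.Nonempty)
    (hdir : DirectedOn (· ≤ ·) s) (hpos : ∀ S ∈ s, 0 ≤ S) (hT : IsLUB s T) :
    vectorWeight ξ T = ⨆ S ∈ s, vectorWeight ξ S := by
  refine le_antisymm ?_ (iSup₂_le fun S hS => vectorWeight_mono ξ (hT.1 hS))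
  rw [vectorWeight, ENNReal.tsum_eq_iSup_sum]
  simp only [ofReal_re_inner_eq_iSup_of_isLUB hne hdir hpos hT, iSup_subtype']
  refine iSup_le fun F => ?_
  rw [ENNReal.finsetSum_iSup fun S S' => ?_]
  · exact iSup_mono fun S => ENNReal.sum_le_tsum F
  · obtain ⟨S'', hS'', h, h'⟩ := hdir S S.2 S' S'.2
    exact ⟨⟨S'', hS''⟩, fun i => ⟨ENNReal.ofReal_le_ofReal (inner_apply_self_mono h (ξ i)).1,
      ENNReal.ofReal_le_ofReal (inner_apply_self_mono h' (ξ i)).1⟩⟩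

end VectorWeight

section Resolution

variable {H : Type*} [NormedAddCommGroup H] [InnerProductSpace ℂ H] [CompleteSpace H] {ι : Type*}

/-- A resolution of the identity: pairwise orthogonal projections which sum up to the identity in
the strong operator topology. -/
structure IsResolutionOfIdentity (q : ι → H →L[ℂ] H) : Prop where
  isStarProjection : ∀ i, IsStarProjection (q i)
  mul_eq_zero : ∀ i j, i ≠ j → q i * q j = 0
  hasSum : ∀ v, HasSum (fun i => q i v) v

lemma isStarProjection_sum {q : ι → H →L[ℂ] H} (hq : ∀ i, IsStarProjection (q i))
    (hort : ∀ i j, i ≠ j → q i * q j = 0) (s : Finset ι) : IsStarProjection (∑ i ∈ s, q i) where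
  isIdempotentElem := by
    rw [IsIdempotentElem, Finset.sum_mul_sum]
    refine Finset.sum_congr rfl fun i hi => ?_
    rw [Finset.sum_eq_single i (fun j _ hj => hort i j hj.symm) (fun h => absurd hi h),
      (hq i).isIdempotentElem]
  isSelfAdjoint := isSelfAdjoint_sum _ fun i _ => (hq i).isSelfAdjoint

namespace IsResolutionOfIdentity

theorem of_dense_span {q : ι → H →L[ℂ] H} (hq : ∀ i, IsStarProjection (q i))
    (hort : ∀ i j, i ≠ j → q i * q j = 0) {M : Set H} (hM : Dense (Submodule.span ℂ M : Set H))
    (hfix : ∀ v ∈ M, ∃ i, q i v = v) : IsResolutionOfIdentity q where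
  isStarProjection := hq
  mul_eq_zero := hort
  hasSum := by
    have hspan : ∀ w ∈ Submodule.span ℂ M, HasSum (fun i => q i w) w := by
      intro w hw
      induction hw using Submodule.span_induction with
      | mem w hw =>
        obtain ⟨i, hi⟩ := hfix w hw
        have hzero : ∀ j, j ≠ i → q j w = 0 := fun j hj => by
          rw [← hi, ← mul_apply_eq_comp, hort j i hj, zero_apply]
        simpa only [hi] using hasSum_single i hzero
      | zero => simpa only [map_zero] using hasSum_zero
      | add w w' _ _ h h' => simpa only [map_add] using h.add h'
      | smul c w _ h => simpa only [map_smul] using h.const_smul c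
    have hlip : ∀ s : Finset ι, LipschitzWith 1 fun v => ∑ i ∈ s, q i v := fun s => by
      simp only [← sum_apply]
      exact (∑ i ∈ s, q i).lipschitz.weaken (isStarProjection_sum hq hort s).norm_le
    have hclosed : IsClosed {v | HasSum (fun i => q i v) v} :=
      (LipschitzWith.uniformEquicontinuous _ 1 hlip).equicontinuous.isClosed_setOfPred_tendsto
        continuous_id
    exact fun v => closure_minimal hspan hclosed (hM v)

variable {q : ι → H →L[ℂ] H} (hq : IsResolutionOfIdentity q)

include hq

lemma eq_zero_of_forall_apply_eq_zero {v : H} (h : ∀ i, q i v = 0) : v = 0 := by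
  have hsum := hq.hasSum v
  simp only [h] at hsum
  exact hsum.unique hasSum_zero

lemma exists_mul_ne_zero {T : H →L[ℂ] H} (hT : T ≠ 0) : ∃ i, q i * T ≠ 0 := by
  by_contra! h
  refine hT (ContinuousLinearMap.ext fun v => hq.eq_zero_of_forall_apply_eq_zero fun i => ?_)
  rw [← mul_apply_eq_comp, h, zero_apply]

lemma tsum_ofReal_norm_sq {c : ι → H →L[ℂ] H} (hc : ∀ i, star (c i) * c i = q i) (v : H) :
    ∑' i, ENNReal.ofReal (‖c i v‖ ^ 2) = ENNReal.ofReal (‖v‖ ^ 2) := by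
  have hinner : ∀ i, ⟪v, q i v⟫_ℂ = ((‖c i v‖ ^ 2 : ℝ) : ℂ) := fun i => by
    rw [← hc, mul_apply_eq_comp, ContinuousLinearMap.star_eq_adjoint,
      ContinuousLinearMap.adjoint_inner_right, inner_self_eq_norm_sq_to_K]
    norm_cast
  have hself : ⟪v, v⟫_ℂ = ((‖v‖ ^ 2 : ℝ) : ℂ) := by
    rw [inner_self_eq_norm_sq_to_K]
    norm_cast
  have hsum := (hq.hasSum v).mapL (innerSL ℂ v)
  simp only [innerSL_apply_apply, hinner, hself, Complex.hasSum_ofReal] at hsum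
  rw [← hsum.tsum_eq, ENNReal.ofReal_tsum_of_nonneg (fun i => by positivity) hsum.summable]

end IsResolutionOfIdentity

end Resolution

section Semifinite

variable {H : Type*} [NormedAddCommGroup H] [InnerProductSpace ℂ H] [CompleteSpace H] {ι : Type*}
  {N : VonNeumannAlgebra H}

lemma sqrt_mem_vonNeumannAlgebra {T : H →L[ℂ] H} (hT : T ∈ N) : CFC.sqrt T ∈ N := by
  rw [← N.commutant_commutant, VonNeumannAlgebra.mem_commutant_iff]
  intro u hu
  have hcomm : Commute T u := VonNeumannAlgebra.mem_commutant_iff.1 hu T hT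
  exact (Commute.cfcₙ_nnreal hcomm NNReal.sqrt).symm

lemma trace_mono_of_isFNSTrace {τ : (H →L[ℂ] H) → ℝ≥0∞} (hτ : N.IsFNSTrace τ) {S T : H →L[ℂ] H}
    (hS : S ∈ N) (hT : T ∈ N) (hS_nonneg : 0 ≤ S) (h : S ≤ T) : τ S ≤ τ T := by
  rw [← add_sub_cancel S T, hτ.map_add S hS _ (sub_mem hT hS) hS_nonneg (sub_nonneg.2 h)]
  exact le_self_add

lemma isFiniteProjection_of_trace_lt_top {τ : (H →L[ℂ] H) → ℝ≥0∞} (hτ : N.IsFNSTrace τ)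
    {p : H →L[ℂ] H} (hp : p ∈ N) (hproj : IsStarProjection p) (hfin : τ p < ∞) :
    N.IsFiniteProjection p where
  mem := hp
  isStarProjection := hproj
  finite v hv hvp hle := by
    have hrange : v * star v ∈ N := mul_mem hv (star_mem hv)
    have hdiff : p - v * star v ∈ N := sub_mem hp hrange
    have hτ_range : τ (v * star v) = τ p := by rw [← hτ.tracial v hv, hvp]
    have hsum : τ p = τ p + τ (p - v * star v) := by
      have hadd := hτ.map_add _ hrange _ hdiff (mul_star_self_nonneg v) (sub_nonneg.2 hle)
      rwa [add_sub_cancel, hτ_range] at hadd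
    have hτ_diff : τ (p - v * star v) = 0 :=
      (ENNReal.add_right_inj hfin.ne).1 (hsum.symm.trans (add_zero _).symm)
    exact (sub_eq_zero.1 (hτ.faithful _ hdiff (sub_nonneg.2 hle) hτ_diff)).symm

theorem isSemifinite_of_trace_lt_top {τ : (H →L[ℂ] H) → ℝ≥0∞} (hτ : N.IsFNSTrace τ)
    {q : ι → H →L[ℂ] H} (hq : IsResolutionOfIdentity q) (hqN : ∀ i, q i ∈ N)
    (hfin : ∀ i, τ (q i) < ∞) : N.IsSemifinite := by
  intro z hz hz_central hz_proj hz_ne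
  obtain ⟨i, hne⟩ := hq.exists_mul_ne_zero hz_ne
  have hqi := hq.isStarProjection i
  have hcomm : Commute (q i) z := VonNeumannAlgebra.mem_commutant_iff.1 hz_central _ (hqN i)
  have hproj : IsStarProjection (q i * z) := hqi.mul hz_proj hcomm
  have hle_q : q i * z ≤ q i := by
    rw [hproj.le_iff_mul_eq_left hqi, hcomm.eq, mul_assoc, hqi.isIdempotentElem.eq]
  have hle_z : q i * z ≤ z := by
    rw [hproj.le_iff_mul_eq_left hz_proj, mul_assoc, hz_proj.isIdempotentElem.eq]
  have hmem : q i * z ∈ N := mul_mem (hqN i) hz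
  exact ⟨q i * z, isFiniteProjection_of_trace_lt_top hτ hmem hproj
    ((trace_mono_of_isFNSTrace hτ hmem (hqN i) hproj.nonneg hle_q).trans_lt (hfin i)), hne, hle_z⟩

-- With `s = √T`, the witness is `s q s`, whose weight is that of `q T q ≤ ‖T‖ q`.
lemma exists_le_vectorWeight_lt_top (ξ : ι → H)
    (htr : ∀ T ∈ N, vectorWeight ξ (star T * T) = vectorWeight ξ (T * star T))
    {κ : Type*} {q : κ → H →L[ℂ] H} (hq : IsResolutionOfIdentity q) (hqN : ∀ k, q k ∈ N)
    (hfin : ∀ k, vectorWeight ξ (q k) < ∞) {T : H →L[ℂ] H} (hT : T ∈ N) (hT_nonneg : 0 ≤ T)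
    (hT_ne : T ≠ 0) : ∃ S ∈ N, 0 ≤ S ∧ S ≤ T ∧ S ≠ 0 ∧ vectorWeight ξ S < ∞ := by
  set s := CFC.sqrt T
  have hs : s * s = T := CFC.sqrt_mul_sqrt_self T hT_nonneg
  have hs_star : star s = s := (CFC.sqrt_nonneg T).isSelfAdjoint.star_eq
  obtain ⟨k, hk⟩ := hq.exists_mul_ne_zero (T := s) fun h => hT_ne (by rw [← hs, h, zero_mul])
  have hqk := hq.isStarProjection k
  have hqk_star := hqk.isSelfAdjoint.star_eq
  have hqs : q k * s ∈ N := mul_mem (hqN k) (sqrt_mem_vonNeumannAlgebra hT)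
  refine ⟨star (q k * s) * (q k * s), mul_mem (star_mem hqs) hqs, star_mul_self_nonneg _, ?_,
    fun h => hk ((CStarRing.star_mul_self_eq_zero_iff _).1 h), ?_⟩
  · calc star (q k * s) * (q k * s) = star s * q k * s := by
          rw [star_mul, hqk_star, mul_assoc, ← mul_assoc (q k), hqk.isIdempotentElem.eq, mul_assoc]
      _ ≤ star s * 1 * s := star_left_conjugate_le_conjugate hqk.le_one s
      _ = T := by rw [mul_one, hs_star, hs]
  · have hle : q k * s * star (q k * s) ≤ ((‖T‖₊ : ℝ≥0) : ℂ) • q k :=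
      calc q k * s * star (q k * s) = star (q k) * T * q k := by
            rw [star_mul, hqk_star, hs_star, ← hs]; simp only [mul_assoc]
        _ ≤ ‖T‖ • (star (q k) * q k) :=
            CStarAlgebra.star_left_conjugate_le_norm_smul hT_nonneg.isSelfAdjoint
        _ = ((‖T‖₊ : ℝ≥0) : ℂ) • q k := by rw [hqk_star, hqk.isIdempotentElem.eq]; rfl
    rw [htr _ hqs]
    refine (vectorWeight_mono ξ hle).trans_lt ?_
    rw [vectorWeight_smul]
    exact ENNReal.mul_lt_top ENNReal.coe_lt_top (hfin k)

theorem isFNSTrace_vectorWeight (ξ : ι → H)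
    (htr : ∀ T ∈ N, vectorWeight ξ (star T * T) = vectorWeight ξ (T * star T))
    (hsep : ∀ T ∈ N, (∀ i, T (ξ i) = 0) → T = 0)
    {κ : Type*} {q : κ → H →L[ℂ] H} (hq : IsResolutionOfIdentity q) (hqN : ∀ k, q k ∈ N)
    (hfin : ∀ k, vectorWeight ξ (q k) < ∞) : N.IsFNSTrace (vectorWeight ξ) where
  map_add _ _ _ _ hS hT := vectorWeight_add ξ hS hT
  map_smul c T _ _ := vectorWeight_smul ξ c T
  tracial := htr
  faithful T hT hT_nonneg h := hsep T hT (apply_eq_zero_of_vectorWeight_eq_zero ξ hT_nonneg h)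
  normal _ _ hne hdir hs hT := vectorWeight_eq_iSup_of_isLUB ξ hne hdir (fun S hS => (hs S hS).2) hT
  semifinite _ hT hT_nonneg hT_ne :=
    exists_le_vectorWeight_lt_top ξ htr hq hqN hfin hT hT_nonneg hT_ne

end Semifinite

section Diagonal

variable {H : Type*} [NormedAddCommGroup H] [InnerProductSpace ℂ H] {ι : Type*}

/-- For a resolution of the identity `q`, the graph of the diagonal operator `∑ cᵢ qᵢ`, with its
maximal domain. -/
def diagonalGraph (q : ι → H →L[ℂ] H) (c : ι → ℂ) : Submodule ℂ (H × H) :=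
  ⨅ i, (q i ∘L ContinuousLinearMap.snd ℂ H H - c i • q i ∘L ContinuousLinearMap.fst ℂ H H).ker

variable {q : ι → H →L[ℂ] H} {c : ι → ℂ}

lemma mem_diagonalGraph {p : H × H} :
    p ∈ diagonalGraph q c ↔ ∀ i, q i p.2 = c i • q i p.1 := by
  simp [diagonalGraph, Submodule.mem_iInf, sub_eq_zero]

lemma isClosed_diagonalGraph : IsClosed (diagonalGraph q c : Set (H × H)) := by
  rw [diagonalGraph, Submodule.coe_iInf]
  exact isClosed_iInter fun i => ContinuousLinearMap.isClosed_ker _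

variable [CompleteSpace H]

lemma apply_mem_diagonalGraph (hq : IsResolutionOfIdentity q) (i : ι) {v : H} (hv : q i v = v) :
    (v, c i • v) ∈ diagonalGraph q c := by
  rw [mem_diagonalGraph]
  intro j
  obtain rfl | hne := eq_or_ne j i
  · rw [map_smul]
  · have hzero : q j v = 0 := by
      rw [← hv, ← mul_apply_eq_comp, hq.mul_eq_zero j i hne, zero_apply]
    rw [map_smul, hzero, smul_zero, smul_zero]

lemma graph_toLinearPMap_diagonalGraph (hq : IsResolutionOfIdentity q) :
    (diagonalGraph q c).toLinearPMap.graph = diagonalGraph q c := by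
  refine Submodule.toLinearPMap_graph_eq _ fun p hp hzero =>
    hq.eq_zero_of_forall_apply_eq_zero fun i => ?_
  rw [mem_diagonalGraph.1 hp i, hzero, map_zero, smul_zero]

theorem isAffiliated_diagonal {N : VonNeumannAlgebra H} (hq : IsResolutionOfIdentity q)
    (hqN : ∀ i, q i ∈ N) : N.IsAffiliated (diagonalGraph q c).toLinearPMap where
  isClosed := by
    rw [LinearPMap.IsClosed, graph_toLinearPMap_diagonalGraph hq]
    exact isClosed_diagonalGraph
  dense_domain v := by
    refine mem_closure_of_tendsto (hq.hasSum v) (Eventually.of_forall fun s =>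
      sum_mem fun i _ => LinearPMap.mem_domain_of_mem_graph (y := c i • q i v) ?_)
    rw [graph_toLinearPMap_diagonalGraph hq]
    refine apply_mem_diagonalGraph hq i ?_
    rw [← mul_apply_eq_comp, (hq.isStarProjection i).isIdempotentElem.eq]
  commute u hu _ v := by
    have hv := LinearPMap.mem_graph _ v
    rw [graph_toLinearPMap_diagonalGraph hq, mem_diagonalGraph] at hv
    have huv : (u (v : H), u ((diagonalGraph q c).toLinearPMap v)) ∈
        (diagonalGraph q c).toLinearPMap.graph := by
      rw [graph_toLinearPMap_diagonalGraph hq, mem_diagonalGraph]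
      intro i
      have hcomm := VonNeumannAlgebra.mem_commutant_iff.1 hu _ (hqN i)
      rw [← mul_apply_eq_comp, ← mul_apply_eq_comp, hcomm, mul_apply_eq_comp, mul_apply_eq_comp,
        hv i, map_smul]
    exact ⟨LinearPMap.mem_domain_of_mem_graph huv, ((LinearPMap.image_iff _).2 huv).symm⟩

lemma apply_mem_span_of_mem_span {κ : Type*} (hq : IsResolutionOfIdentity q) {v : κ → H}
    {k : κ → ι} (hfix : ∀ j, q (k j) (v j) = v j) (i : ι) {w : H}
    (hw : w ∈ Submodule.span ℂ (Set.range v)) :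
    (q i w, c i • q i w) ∈ Submodule.span ℂ (Set.range fun j => (v j, c (k j) • v j)) := by
  induction hw using Submodule.span_induction with
  | mem w hw =>
    obtain ⟨j, rfl⟩ := hw
    obtain rfl | hne := eq_or_ne i (k j)
    · rw [hfix]
      exact Submodule.subset_span ⟨j, rfl⟩
    · rw [← hfix, ← mul_apply_eq_comp, hq.mul_eq_zero i (k j) hne, zero_apply, smul_zero]
      exact zero_mem _
  | zero =>
    rw [map_zero, smul_zero]
    exact zero_mem _
  | add w w' _ _ h h' =>
    rw [map_add, smul_add]
    exact add_mem h h'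
  | smul a w _ h =>
    rw [map_smul, smul_comm]
    exact Submodule.smul_mem _ a h

theorem topologicalClosure_span_eq_diagonalGraph {κ : Type*} (hq : IsResolutionOfIdentity q)
    {v : κ → H} {k : κ → ι} (hfix : ∀ j, q (k j) (v j) = v j)
    (hv : Dense (Submodule.span ℂ (Set.range v) : Set H)) :
    (Submodule.span ℂ (Set.range fun j => (v j, c (k j) • v j))).topologicalClosure =
      diagonalGraph q c := by
  refine le_antisymm (Submodule.topologicalClosure_minimal _ ?_ isClosed_diagonalGraph)
    fun p hp => ?_
  · rw [Submodule.span_le]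
    rintro _ ⟨j, rfl⟩
    exact apply_mem_diagonalGraph hq (k j) (hfix j)
  · set G := (Submodule.span ℂ (Set.range fun j => (v j, c (k j) • v j))).topologicalClosure
    have hG : IsClosed (G : Set (H × H)) := Submodule.isClosed_topologicalClosure _
    have hcomponent : ∀ i w, (q i w, c i • q i w) ∈ G := by
      intro i w
      have hclosed : IsClosed {w | (q i w, c i • q i w) ∈ G} :=
        hG.preimage ((q i).continuous.prodMk (c i • q i).continuous)
      have hspan : (Submodule.span ℂ (Set.range v) : Set H) ⊆ {w | (q i w, c i • q i w) ∈ G} :=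
        fun w hw => Submodule.le_topologicalClosure _ (apply_mem_span_of_mem_span hq hfix i hw)
      exact closure_minimal hspan hclosed (hv w)
    have hsum := (hq.hasSum p.1).prodMk (hq.hasSum p.2)
    simp only [mem_diagonalGraph.1 hp] at hsum
    exact hG.mem_of_tendsto hsum (Eventually.of_forall fun s => sum_mem fun i _ =>
      hcomponent i p.1)

end Diagonal

section HilbertBasis

variable {H : Type*} [NormedAddCommGroup H] [InnerProductSpace ℂ H] [CompleteSpace H] {ι : Type*}
  (b : HilbertBasis ι ℂ H)

/-- The isometry sending the basis vector `b m` to `b (j m)`. -/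
noncomputable def basisIsometry {j : ι → ι} (hj : j.Injective) : H →L[ℂ] H :=
  ((b.orthonormal.comp j hj).orthogonalFamily.linearIsometry.comp
    b.repr.toLinearIsometry).toContinuousLinearMap

lemma basisIsometry_apply {j : ι → ι} (hj : j.Injective) (m : ι) :
    basisIsometry b hj (b m) = b (j m) := by
  classical
  change (b.orthonormal.comp j hj).orthogonalFamily.linearIsometry (b.repr (b m)) = _
  rw [b.repr_self, OrthogonalFamily.linearIsometry_apply_single,
    LinearIsometry.toSpanSingleton_apply, one_smul, Function.comp_apply]

lemma star_basisIsometry_mul_self {j : ι → ι} (hj : j.Injective) :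
    star (basisIsometry b hj) * basisIsometry b hj = 1 :=
  ContinuousLinearMap.norm_map_iff_adjoint_comp_self _ |>.1 (LinearIsometry.norm_map _)

lemma star_basisIsometry_apply {j : ι → ι} (hj : j.Injective) (m : ι) :
    star (basisIsometry b hj) (b (j m)) = b m := by
  rw [← basisIsometry_apply b hj, ← mul_apply_eq_comp, star_basisIsometry_mul_self]
  rfl

lemma star_basisIsometry_apply_of_notMem {j : ι → ι} (hj : j.Injective) {k : ι}
    (hk : k ∉ Set.range j) : star (basisIsometry b hj) (b k) = 0 := by
  refine b.repr.injective (lp.ext (funext fun m => ?_))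
  rw [b.repr_apply_apply, ContinuousLinearMap.star_eq_adjoint,
    ContinuousLinearMap.adjoint_inner_right, basisIsometry_apply,
    b.orthonormal.2 fun h => hk ⟨m, h⟩, map_zero]
  rfl

include b in
theorem exists_isometries_sum_mul_star_eq_one {κ : Type*} [Fintype κ] (e : κ × ι ≃ ι) :
    ∃ S : κ → H →L[ℂ] H, (∀ i, star (S i) * S i = 1) ∧ ∑ i, S i * star (S i) = 1 := by
  have hinj : ∀ i, Function.Injective fun m => e (i, m) := fun i m m' h =>
    (Prod.ext_iff.1 (e.injective h)).2
  refine ⟨fun i => basisIsometry b (hinj i), fun i => star_basisIsometry_mul_self b _,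
    ContinuousLinearMap.ext_on
    (Submodule.dense_iff_topologicalClosure_eq_top.2 b.dense_span) ?_⟩
  rintro _ ⟨k, rfl⟩
  obtain ⟨⟨i, m⟩, rfl⟩ := e.surjective k
  rw [sum_apply, Finset.sum_eq_single i, mul_apply_eq_comp, star_basisIsometry_apply b (hinj i),
    basisIsometry_apply]
  · rfl
  · intro i' _ hne
    rw [mul_apply_eq_comp, star_basisIsometry_apply_of_notMem, map_zero]
    rintro ⟨m', h⟩
    exact hne (Prod.ext_iff.1 (e.injective h)).1
  · exact fun h => absurd (Finset.mem_univ i) h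

end HilbertBasis

namespace CuntzAlgebra

section Words

variable {n : ℕ}

instance [NeZero n] : Nontrivial (CuntzAlgebra n) := by
  obtain ⟨S, hS⟩ := exists_isometries_sum_mul_star_eq_one
    (HilbertBasis.ofRepr (LinearIsometryEquiv.refl ℂ SeqHilbert))
    ((Equiv.prodComm _ _).trans (Nat.divModEquiv n).symm)
  refine ⟨1, 0, fun h => one_ne_zero (α := SeqHilbert →L[ℂ] SeqHilbert) ?_⟩
  exact congrFun (congrArg (fun a : CuntzAlgebra n => (a.1 : ∀ r, _)) h) (⟨S, hS⟩ : CuntzFamily n)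

lemma star_gen_mul_gen_of_ne {i j : Fin n} (h : i ≠ j) :
    star (gen i) * gen j = (0 : CuntzAlgebra n) := by
  have hsum : ∑ k : Fin n, star (star (gen k) * gen j) * (star (gen k) * gen j) =
      (1 : CuntzAlgebra n) := by
    calc ∑ k : Fin n, star (star (gen k) * gen j) * (star (gen k) * gen j) =
        ∑ k : Fin n, star (gen j) * (gen k * star (gen k)) * (gen j : CuntzAlgebra n) := by
          simp only [star_mul, star_star, mul_assoc]
      _ = 1 := by
          rw [← Finset.sum_mul, ← Finset.mul_sum, sum_gen_mul_star, mul_one, star_gen_mul_gen]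
  have herase : ∑ k ∈ Finset.univ.erase j,
      star (star (gen k) * gen j) * (star (gen k) * gen j) = (0 : CuntzAlgebra n) := by
    rw [← Finset.add_sum_erase _ _ (Finset.mem_univ j), star_gen_mul_gen] at hsum
    simpa only [star_one, mul_one, add_eq_left] using hsum
  have hterm := (Finset.sum_eq_zero_iff_of_nonneg fun k _ => star_mul_self_nonneg _).1 herase i
    (Finset.mem_erase.2 ⟨h, Finset.mem_univ i⟩)
  exact (CStarRing.star_mul_self_eq_zero_iff _).1 hterm

/-- The isometry `S_μ` of a word `μ`. -/
noncomputable def word (μ : List (Fin n)) : CuntzAlgebra n := (μ.map gen).prod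

@[simp] lemma word_nil : word ([] : List (Fin n)) = 1 := rfl

@[simp] lemma word_cons (i : Fin n) (μ : List (Fin n)) : word (i :: μ) = gen i * word μ := by
  simp [word]

lemma word_append (μ ν : List (Fin n)) : word (μ ++ ν) = word μ * word ν := by
  simp [word]

lemma monomial_eq (μ ν : List (Fin n)) : monomial μ ν = word μ * star (word ν) := rfl

@[simp] lemma star_word_mul_word (μ : List (Fin n)) : star (word μ) * word μ = 1 := by
  induction μ with
  | nil => simp
  | cons i μ ih =>
    rw [word_cons, star_mul, mul_assoc, ← mul_assoc (star (gen i)), star_gen_mul_gen, one_mul, ih]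

lemma star_word_mul_word_of_ne {μ ν : List (Fin n)} (hl : μ.length = ν.length) (h : μ ≠ ν) :
    star (word μ) * word ν = 0 := by
  induction μ generalizing ν with
  | nil => exact absurd (List.length_eq_zero_iff.1 hl.symm).symm h
  | cons i μ ih =>
    obtain ⟨j, ν, rfl⟩ := List.exists_cons_of_length_eq_add_one hl.symm
    rw [word_cons, word_cons, star_mul, mul_assoc, ← mul_assoc (star (gen i))]
    obtain rfl | hij := eq_or_ne i j
    · rw [star_gen_mul_gen, one_mul]
      exact ih (Nat.succ_injective hl) (fun h' => h (by rw [h']))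
    · rw [star_gen_mul_gen_of_ne hij, zero_mul, mul_zero]

lemma monomial_mem_algSpan (μ ν : List (Fin n)) : monomial μ ν ∈ algSpan n :=
  Submodule.subset_span ⟨μ, ν, rfl⟩

lemma word_mem_algSpan (μ : List (Fin n)) : word μ ∈ algSpan n := by
  simpa [monomial_eq] using monomial_mem_algSpan μ []

lemma star_word_mem_algSpan (μ : List (Fin n)) : star (word μ) ∈ algSpan n := by
  simpa [monomial_eq] using monomial_mem_algSpan [] μ

lemma mul_mem_algSpan_of_monomial {a : CuntzAlgebra n}
    (h : ∀ μ ν, a * monomial μ ν ∈ algSpan n) {x : CuntzAlgebra n} (hx : x ∈ algSpan n) :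
    a * x ∈ algSpan n := by
  have hle : algSpan n ≤ (algSpan n).comap (LinearMap.mulLeft ℂ a) := by
    rw [algSpan, Submodule.span_le]
    rintro _ ⟨μ, ν, rfl⟩
    exact h μ ν
  exact hle hx

lemma gen_mul_mem_algSpan (i : Fin n) {x : CuntzAlgebra n} (hx : x ∈ algSpan n) :
    gen i * x ∈ algSpan n :=
  mul_mem_algSpan_of_monomial (fun μ ν => by
    simpa [monomial_eq, mul_assoc] using monomial_mem_algSpan (i :: μ) ν) hx

lemma star_gen_mul_mem_algSpan (i : Fin n) {x : CuntzAlgebra n} (hx : x ∈ algSpan n) :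
    star (gen i) * x ∈ algSpan n := by
  refine mul_mem_algSpan_of_monomial (fun μ ν => ?_) hx
  cases μ with
  | nil => simpa [monomial_eq, word_append] using monomial_mem_algSpan [] (ν ++ [i])
  | cons j μ =>
    rw [monomial_eq, word_cons, mul_assoc, ← mul_assoc]
    obtain rfl | hij := eq_or_ne i j
    · rw [star_gen_mul_gen, one_mul]
      exact monomial_mem_algSpan μ ν
    · rw [star_gen_mul_gen_of_ne hij, zero_mul]
      exact zero_mem _

lemma mul_mem_algSpan_of_mem_adjoin {a : CuntzAlgebra n}
    (ha : a ∈ StarAlgebra.adjoin ℂ (Set.range gen)) :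
    (∀ x ∈ algSpan n, a * x ∈ algSpan n) ∧ ∀ x ∈ algSpan n, star a * x ∈ algSpan n := by
  induction ha using StarAlgebra.adjoin_induction with
  | mem a ha =>
    obtain ⟨i, rfl⟩ := ha
    exact ⟨fun x => gen_mul_mem_algSpan i, fun x => star_gen_mul_mem_algSpan i⟩
  | algebraMap c =>
    rw [← algebraMap_star_comm]
    simp only [← Algebra.smul_def]
    exact ⟨fun x => Submodule.smul_mem _ _, fun x => Submodule.smul_mem _ _⟩
  | add a b _ _ ha hb =>
    simp only [star_add, add_mul]
    exact ⟨fun x hx => add_mem (ha.1 x hx) (hb.1 x hx), fun x hx => add_mem (ha.2 x hx) (hb.2 x hx)⟩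
  | mul a b _ _ ha hb =>
    simp only [star_mul, mul_assoc]
    exact ⟨fun x hx => ha.1 _ (hb.1 x hx), fun x hx => hb.2 _ (ha.2 x hx)⟩
  | star a _ ha => rw [star_star]; exact ha.symm

lemma dense_adjoin_gen :
    Dense (StarAlgebra.adjoin ℂ (Set.range (gen (n := n))) : Set (CuntzAlgebra n)) := by
  have himage : (incl n : CuntzAlgebra n → CuntzAmbient n) ''
      (StarAlgebra.adjoin ℂ (Set.range (gen (n := n)))) =
      (StarAlgebra.adjoin ℂ (Set.range (cuntzAmbientGen n)) : Set (CuntzAmbient n)) := by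
    rw [← StarSubalgebra.coe_map, StarAlgHom.map_adjoin, ← Set.range_comp]
    rfl
  intro a
  refine closure_subtype.2 ?_
  change incl n a ∈ closure (incl n '' _)
  rw [himage]
  exact a.2

lemma dense_algSpan : Dense (algSpan n : Set (CuntzAlgebra n)) :=
  dense_adjoin_gen.mono fun a ha => by
    simpa using (mul_mem_algSpan_of_mem_adjoin ha).1 1 (by simpa using word_mem_algSpan [])

end Words

end CuntzAlgebra

lemma nonneg_of_algebraMap_nonneg {A : Type*} [CStarAlgebra A] [PartialOrder A] [StarOrderedRing A]
    [Nontrivial A] {c : ℂ} (h : 0 ≤ algebraMap ℂ A c) : 0 ≤ c := by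
  refine spectrum_nonneg_of_nonneg (𝕜 := ℂ) h ?_
  rw [spectrum.scalar_eq]
  exact Set.mem_singleton c

lemma exists_mem_tendsto_of_equicontinuousAt {X Y : Type*} [PseudoMetricSpace X]
    [PseudoMetricSpace Y] [CompleteSpace Y] {T : ℕ → X → Y} {a : X} (hT : EquicontinuousAt T a)
    {s : Set X} (ha : a ∈ closure s) {C : Set Y} (hC : IsClosed C)
    (h : ∀ b ∈ s, ∃ y ∈ C, Tendsto (fun m => T m b) atTop (𝓝 y)) :
    ∃ y ∈ C, Tendsto (fun m => T m a) atTop (𝓝 y) := by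
  have hclose : ∀ ε > 0, ∃ y ∈ C, ∀ᶠ m in atTop, dist (T m a) y < ε := by
    intro ε hε
    obtain ⟨δ, hδ, hTδ⟩ := Metric.equicontinuousAt_iff.1 hT (ε / 2) (half_pos hε)
    obtain ⟨b, hb, hab⟩ := Metric.mem_closure_iff.1 ha δ hδ
    obtain ⟨y, hy, hby⟩ := h b hb
    refine ⟨y, hy, (Metric.tendsto_nhds.1 hby (ε / 2) (half_pos hε)).mono fun m hm => ?_⟩
    rw [dist_comm] at hab
    linarith [dist_triangle (T m a) (T m b) y, hTδ b hab m]
  have hcauchy : CauchySeq fun m => T m a := by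
    refine Metric.cauchySeq_iff'.2 fun ε hε => ?_
    obtain ⟨y, -, hy⟩ := hclose (ε / 2) (half_pos hε)
    obtain ⟨N, hN⟩ := eventually_atTop.1 hy
    exact ⟨N, fun m hm => by
      linarith [dist_triangle_right (T m a) (T N a) y, hN m hm, hN N le_rfl]⟩
  obtain ⟨x, hx⟩ := cauchySeq_tendsto_of_complete hcauchy
  refine ⟨x, hC.closure_subset (Metric.mem_closure_iff.2 fun ε hε => ?_), hx⟩
  obtain ⟨y, hyC, hy⟩ := hclose (ε / 2) (half_pos hε)
  refine ⟨y, hyC, lt_of_le_of_lt ?_ (half_lt_self hε)⟩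
  exact le_of_tendsto (hx.dist tendsto_const_nhds) (hy.mono fun m hm => hm.le)

section Tracial

variable {A : Type*} [CStarAlgebra A] [PartialOrder A]

/-- A positive functional is tracial if it vanishes on commutators. -/
def IsTracial (τ : A →ₚ[ℂ] ℂ) : Prop := ∀ a b, τ (a * b) = τ (b * a)

variable [StarOrderedRing A] {τ : A →ₚ[ℂ] ℂ}

lemma IsTracial.apply_star_mul_mul_le (hτ : IsTracial τ) {c : A} (hc : 0 ≤ c) (f : A) :
    τ (star f * c * f) ≤ ((‖f‖ ^ 2 : ℝ) : ℂ) * τ c := by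
  obtain ⟨s, rfl⟩ := CStarAlgebra.nonneg_iff_eq_star_mul_self.1 hc
  have hswap : τ (star s * s) = τ (s * star s) := hτ _ _
  calc τ (star f * (star s * s) * f) = τ (s * (f * star f) * star s) := by
        rw [show star f * (star s * s) * f = star f * star s * (s * f) by simp only [mul_assoc], hτ]
        simp only [mul_assoc]
    _ ≤ τ (((‖f‖ ^ 2 : ℝ) : ℂ) • (s * star s)) := by
        refine OrderHomClass.mono τ ?_
        have h := CStarAlgebra.star_right_conjugate_le_norm_smul (a := s)
          (IsSelfAdjoint.mul_star_self f)
        rwa [CStarRing.norm_self_mul_star, ← sq, ← Complex.coe_smul] at h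
    _ = ((‖f‖ ^ 2 : ℝ) : ℂ) * τ (star s * s) := by rw [map_smul, smul_eq_mul, hswap]

lemma gnsStarAlgHom_apply_coe (τ : A →ₚ[ℂ] ℂ) (a b : A) :
    τ.gnsStarAlgHom a (τ.toPreGNS b : τ.GNS) = (τ.toPreGNS (a * b) : τ.GNS) :=
  PositiveLinearMap.gnsNonUnitalStarAlgHom_apply_coe τ

lemma norm_toPreGNS_eq_zero_iff (τ : A →ₚ[ℂ] ℂ) (a : A) :
    ‖(τ.toPreGNS a : τ.GNS)‖ = 0 ↔ τ (star a * a) = 0 := by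
  rw [UniformSpace.Completion.norm_coe, ← sq_eq_zero_iff, ← Complex.ofReal_eq_zero,
    Complex.ofReal_pow, τ.preGNS_norm_sq, τ.ofPreGNS_toPreGNS]

-- The vectors `b̂` are dense in the GNS space, and `‖(a b)^‖² = τ(b* a* a b) = τ(a b b* a*)` is at
-- most `‖b‖² τ(a a*) = ‖b‖² τ(a* a)`.
lemma IsTracial.gnsStarAlgHom_eq_zero (hτ : IsTracial τ) {a : A} (ha : τ (star a * a) = 0) :
    τ.gnsStarAlgHom a = 0 := by
  refine DFunLike.coe_injective <| UniformSpace.Completion.denseRange_coe.equalizer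
    (ContinuousLinearMap.continuous _) continuous_zero (funext fun b => ?_)
  obtain ⟨b, rfl⟩ := τ.toPreGNS.surjective b
  have h := hτ.apply_star_mul_mul_le (star_mul_self_nonneg a) b
  rw [ha, mul_zero] at h
  change τ.gnsStarAlgHom a (τ.toPreGNS b : τ.GNS) = 0
  rw [gnsStarAlgHom_apply_coe, ← norm_eq_zero, norm_toPreGNS_eq_zero_iff]
  refine le_antisymm ?_ (τ.map_nonneg (star_mul_self_nonneg _))
  simpa only [star_mul, mul_assoc] using h

lemma norm_gnsStarAlgHom_of_faithful_on (τ : A →ₚ[ℂ] ℂ) {B : StarSubalgebra ℂ A}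
    (hB : IsClosed (B : Set A)) (hf : ∀ a ∈ B, τ (star a * a) = 0 → a = 0) {a : A} (ha : a ∈ B) :
    ‖τ.gnsStarAlgHom a‖ = ‖a‖ := by
  have : IsClosed (B : Set A) := hB
  let ρ : B →⋆ₐ[ℂ] (τ.GNS →L[ℂ] τ.GNS) := τ.gnsStarAlgHom.comp B.subtype
  refine NonUnitalStarAlgHom.norm_map ρ ((injective_iff_map_eq_zero ρ).2 fun b hb => ?_) ⟨a, ha⟩
  refine Subtype.ext (hf b b.2 ((norm_toPreGNS_eq_zero_iff τ _).1 (norm_eq_zero.2 ?_)))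
  rw [← mul_one (b : A), ← gnsStarAlgHom_apply_coe]
  exact DFunLike.congr_fun hb _

theorem IsTracial.faithful_of_dense_iUnion (hτ : IsTracial τ) {ι : Type*}
    {B : ι → StarSubalgebra ℂ A} (hB : ∀ i, IsClosed (B i : Set A))
    (hdense : Dense (⋃ i, (B i : Set A)))
    (hf : ∀ i, ∀ a ∈ B i, τ (star a * a) = 0 → a = 0) {a : A} (ha : τ (star a * a) = 0) :
    a = 0 := by
  have hnorm : (fun a => ‖τ.gnsStarAlgHom a‖) = fun a => ‖a‖ := by
    refine Continuous.ext_on hdense (map_continuous τ.gnsStarAlgHom).norm continuous_norm ?_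
    intro a ha
    obtain ⟨i, hi⟩ := Set.mem_iUnion.1 ha
    exact norm_gnsStarAlgHom_of_faithful_on τ (hB i) (hf i) hi
  rw [← norm_eq_zero, ← congrFun hnorm a, hτ.gnsStarAlgHom_eq_zero ha, norm_zero]

end Tracial

namespace CuntzAlgebra

lemma isClosed_core (n : ℕ) : IsClosed (core n : Set (CuntzAlgebra n)) := by
  have h : (core n : Set (CuntzAlgebra n)) = ⋂ z : Circle, {a | gauge z a = a} := by
    ext a
    rw [Set.mem_iInter]
    rfl
  rw [h]
  exact isClosed_iInter fun z => isClosed_eq (gaugeL z).continuous continuous_id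

-- Only local, since it provides a second path to the ring structure of `core n`.
attribute [local instance] isClosed_core

section Degree

variable {n : ℕ}

/-- The elements of degree `d` for the gauge action. -/
def IsHomogeneous (d : ℤ) (a : CuntzAlgebra n) : Prop :=
  ∀ z : Circle, gauge z a = (z : ℂ) ^ d • a

lemma IsHomogeneous.mul {d e : ℤ} {a b : CuntzAlgebra n} (ha : IsHomogeneous d a)
    (hb : IsHomogeneous e b) : IsHomogeneous (d + e) (a * b) := fun z => by
  rw [map_mul, ha z, hb z, smul_mul_smul_comm, zpow_add₀ (Circle.coe_ne_zero z)]

lemma IsHomogeneous.star {d : ℤ} {a : CuntzAlgebra n} (ha : IsHomogeneous d a) :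
    IsHomogeneous (-d) (star a) := fun z => by
  rw [map_star, ha z, star_smul, zpow_neg, ← inv_zpow, ← Circle.coe_inv, Circle.coe_inv_eq_conj,
    ← starRingEnd_apply, map_zpow₀]

lemma isHomogeneous_zero_iff {a : CuntzAlgebra n} : IsHomogeneous 0 a ↔ a ∈ core n := by
  refine forall_congr' fun z => ?_
  rw [zpow_zero, one_smul]

lemma isHomogeneous_gen (i : Fin n) : IsHomogeneous 1 (gen i : CuntzAlgebra n) := fun z => by
  rw [gauge_gen, zpow_one]

lemma isHomogeneous_word (μ : List (Fin n)) : IsHomogeneous (μ.length : ℤ) (word μ) := by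
  induction μ with
  | nil => exact isHomogeneous_zero_iff.2 (one_mem _)
  | cons i μ ih =>
    rw [word_cons, List.length_cons, Nat.cast_succ, add_comm]
    exact (isHomogeneous_gen i).mul ih

lemma isHomogeneous_monomial (μ ν : List (Fin n)) :
    IsHomogeneous ((μ.length : ℤ) - ν.length) (monomial μ ν) :=
  (isHomogeneous_word μ).mul (isHomogeneous_word ν).star

lemma monomial_mem_core {μ ν : List (Fin n)} (h : μ.length = ν.length) :
    monomial μ ν ∈ core n := by
  have := isHomogeneous_monomial μ ν
  rwa [h, sub_self, isHomogeneous_zero_iff] at this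

end Degree

section Expectation

variable {n : ℕ}

instance : StarOrderedRing (core n) := by
  refine .of_nonneg_iff' (fun h z => add_le_add_right h z) fun a => ⟨fun ha => ?_, ?_⟩
  · have hs : CFC.sqrt (a : CuntzAlgebra n) ∈ core n := fun z => by
      refine (CFC.sqrt_unique ?_ (map_nonneg (gauge z) (CFC.sqrt_nonneg _))).symm
      rw [← map_mul, CFC.sqrt_mul_sqrt_self (a : CuntzAlgebra n) ha, a.2 z]
    refine ⟨⟨_, hs⟩, Subtype.ext ?_⟩
    change (a : CuntzAlgebra n) = star (CFC.sqrt (a : CuntzAlgebra n)) * CFC.sqrt _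
    rw [(CFC.sqrt_nonneg (a : CuntzAlgebra n)).isSelfAdjoint.star_eq,
      CFC.sqrt_mul_sqrt_self (a : CuntzAlgebra n) ha]
  · rintro ⟨s, rfl⟩
    exact star_mul_self_nonneg (s : CuntzAlgebra n)

lemma expectation_coe (f : core n) : expectation n (f : CuntzAlgebra n) = f := by
  have h : ∀ z : Circle, gauge z (f : CuntzAlgebra n) = f := f.2
  refine Subtype.ext ?_
  change gaugeMean _ = _
  simp only [gaugeMean, h, intervalIntegral.integral_const, sub_zero]
  rw [smul_smul, inv_mul_cancel₀ Real.two_pi_pos.ne', one_smul]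

lemma IsHomogeneous.expectation_eq_zero {d : ℤ} (hd : d ≠ 0) {a : CuntzAlgebra n}
    (ha : IsHomogeneous d a) : expectation n a = 0 := by
  have hexp : ∀ θ : ℝ, gauge (Circle.exp θ) a = Complex.exp (d * Complex.I * θ) • a := fun θ => by
    rw [ha, Circle.coe_exp, ← Complex.exp_int_mul]
    congr 2
    ring
  have hperiod : Complex.exp (d * Complex.I * ((2 * Real.pi : ℝ) : ℂ)) = 1 := by
    rw [← Complex.exp_int_mul_two_pi_mul_I d]
    push_cast
    ring_nf
  refine Subtype.ext ?_
  change gaugeMean a = 0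
  simp only [gaugeMean, hexp]
  rw [intervalIntegral.integral_smul_const,
    integral_exp_mul_complex (by simp [hd] : (d * Complex.I : ℂ) ≠ 0), hperiod]
  simp

lemma expectation_mul_left (f : core n) (a : CuntzAlgebra n) :
    expectation n (f * a) = f * expectation n a :=
  Subtype.ext (gaugeMean_mul f.2 a)

lemma expectation_mul_right (a : CuntzAlgebra n) (f : core n) :
    expectation n (a * f) = expectation n a * f := by
  rw [← star_star (a * f), map_star, star_mul]
  have h := expectation_mul_left (star f) (star a)
  change expectation n (star (f : CuntzAlgebra n) * star a) = _ at h
  rw [h, star_mul, star_star, map_star, star_star]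

lemma expectation_monomial_of_length_eq {μ ν : List (Fin n)} (h : μ.length = ν.length) :
    expectation n (monomial μ ν) = ⟨monomial μ ν, monomial_mem_core h⟩ :=
  expectation_coe ⟨monomial μ ν, monomial_mem_core h⟩

lemma expectation_monomial_of_length_ne {μ ν : List (Fin n)} (h : μ.length ≠ ν.length) :
    expectation n (monomial μ ν) = 0 :=
  (isHomogeneous_monomial μ ν).expectation_eq_zero (by omega)

lemma dense_expectation_algSpan : Dense (expectation n '' (algSpan n : Set (CuntzAlgebra n))) :=
  (show Function.Surjective (expectation n) from fun f =>
    ⟨f, expectation_coe f⟩).denseRange.dense_image (map_continuous _) dense_algSpan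

end Expectation

section MatrixAlg

variable {n : ℕ}

lemma star_gen_mul_mul_mul_gen (a b : CuntzAlgebra n) (i j : Fin n) :
    star (gen i) * (a * b) * gen j =
      ∑ l, (star (gen i) * a * gen l) * (star (gen l) * b * gen j) := by
  calc star (gen i) * (a * b) * gen j =
      star (gen i) * a * (∑ l, gen l * star (gen l)) * (b * gen j) := by
        rw [sum_gen_mul_star, mul_one]
        simp only [mul_assoc]
    _ = _ := by simp only [Finset.mul_sum, Finset.sum_mul, mul_assoc]

lemma star_gen_mul_algebraMap_mul_gen (i j : Fin n) (c : ℂ) :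
    star (gen i) * algebraMap ℂ (CuntzAlgebra n) c * gen j =
      algebraMap ℂ (CuntzAlgebra n) (if i = j then c else 0) := by
  rw [← Algebra.commutes, mul_assoc]
  split_ifs with h
  · rw [h, star_gen_mul_gen, mul_one]
  · rw [star_gen_mul_gen_of_ne h, mul_zero, map_zero]

/-- The subalgebra spanned by the `S_μ S_ν*` with `|μ| = |ν| = k`, a copy of the `n ^ k × n ^ k`
matrices: its elements are those all of whose matrix entries `S_μ* a S_ν` are scalars. -/
noncomputable def matrixAlg (n : ℕ) : ℕ → StarSubalgebra ℂ (CuntzAlgebra n)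
  | 0 => ⊥
  | k + 1 =>
    { carrier := {a | ∀ i j : Fin n, star (gen i) * a * gen j ∈ matrixAlg n k}
      mul_mem' := fun {a b} ha hb i j => by
        rw [star_gen_mul_mul_mul_gen]
        exact sum_mem fun l _ => mul_mem (ha i l) (hb l j)
      add_mem' := fun {a b} ha hb i j => by
        rw [mul_add, add_mul]
        exact add_mem (ha i j) (hb i j)
      algebraMap_mem' := fun c i j => by
        rw [star_gen_mul_algebraMap_mul_gen]
        exact algebraMap_mem _ _
      star_mem' := fun {a} ha i j => by
        have := star_mem (ha j i)
        rwa [star_mul, star_mul, star_star, ← mul_assoc] at this }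

lemma mem_matrixAlg_zero {a : CuntzAlgebra n} :
    a ∈ matrixAlg n 0 ↔ ∃ c : ℂ, algebraMap ℂ _ c = a :=
  StarSubalgebra.mem_bot

lemma mem_matrixAlg_succ {k : ℕ} {a : CuntzAlgebra n} :
    a ∈ matrixAlg n (k + 1) ↔ ∀ i j : Fin n, star (gen i) * a * gen j ∈ matrixAlg n k := Iff.rfl

lemma isClosed_matrixAlg (k : ℕ) : IsClosed (matrixAlg n k : Set (CuntzAlgebra n)) := by
  induction k with
  | zero =>
    convert (LinearMap.range (Algebra.linearMap ℂ (CuntzAlgebra n))).closed_of_finiteDimensional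
    ext a
    exact mem_matrixAlg_zero
  | succ k ih =>
    have h : (matrixAlg n (k + 1) : Set (CuntzAlgebra n)) =
        ⋂ i : Fin n, ⋂ j : Fin n, (fun a => star (gen i) * a * gen j) ⁻¹' (matrixAlg n k) := by
      ext a
      simp only [SetLike.mem_coe, mem_matrixAlg_succ, Set.mem_iInter, Set.mem_preimage]
    rw [h]
    exact isClosed_iInter fun i => isClosed_iInter fun j => ih.preimage (by fun_prop)

lemma matrixAlg_mono : Monotone (matrixAlg n) := by
  refine monotone_nat_of_le_succ fun k => ?_
  induction k with
  | zero =>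
    intro a ha i j
    obtain ⟨c, rfl⟩ := mem_matrixAlg_zero.1 ha
    rw [star_gen_mul_algebraMap_mul_gen]
    exact algebraMap_mem _ _
  | succ k ih => exact fun a ha i j => ih (ha i j)

lemma monomial_mem_matrixAlg {μ ν : List (Fin n)} (h : μ.length = ν.length) :
    monomial μ ν ∈ matrixAlg n μ.length := by
  induction μ generalizing ν with
  | nil =>
    obtain rfl := List.length_eq_zero_iff.1 h.symm
    simp [monomial_eq]
  | cons i μ ih =>
    obtain ⟨j, ν, rfl⟩ := List.exists_cons_of_length_eq_add_one h.symm
    intro i' j'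
    have hentry : star (gen i') * monomial (i :: μ) (j :: ν) * gen j' =
        (star (gen i') * gen i) * monomial μ ν * (star (gen j) * gen j') := by
      simp only [monomial_eq, word_cons, star_mul, mul_assoc]
    rw [hentry]
    obtain rfl | hi := eq_or_ne i' i
    · obtain rfl | hj := eq_or_ne j j'
      · rw [star_gen_mul_gen, star_gen_mul_gen, one_mul, mul_one]
        exact ih (Nat.succ_injective h)
      · rw [star_gen_mul_gen_of_ne hj, mul_zero]
        exact zero_mem _
    · rw [star_gen_mul_gen_of_ne hi, zero_mul, zero_mul]
      exact zero_mem _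

lemma exists_expectation_mem_matrixAlg {x : CuntzAlgebra n} (hx : x ∈ algSpan n) :
    ∃ k, (expectation n x : CuntzAlgebra n) ∈ matrixAlg n k := by
  induction hx using Submodule.span_induction with
  | mem x hx =>
    obtain ⟨μ, ν, rfl⟩ := hx
    by_cases h : μ.length = ν.length
    · rw [expectation_monomial_of_length_eq h]
      exact ⟨_, monomial_mem_matrixAlg h⟩
    · rw [expectation_monomial_of_length_ne h]
      exact ⟨0, zero_mem _⟩
  | zero => exact ⟨0, by rw [map_zero]; exact zero_mem _⟩
  | add x y _ _ hx hy =>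
    obtain ⟨k, hk⟩ := hx
    obtain ⟨l, hl⟩ := hy
    rw [map_add]
    exact ⟨max k l, add_mem (matrixAlg_mono (le_max_left k l) hk)
      (matrixAlg_mono (le_max_right k l) hl)⟩
  | smul c x _ hx =>
    obtain ⟨k, hk⟩ := hx
    rw [map_smul]
    exact ⟨k, SMulMemClass.smul_mem c hk⟩

lemma dense_iUnion_matrixAlg :
    Dense (⋃ k, ((matrixAlg n k).comap (core n).subtype : Set (core n))) := by
  refine dense_expectation_algSpan.mono ?_
  rintro _ ⟨x, hx, rfl⟩
  exact Set.mem_iUnion.2 (exists_expectation_mem_matrixAlg hx)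

end MatrixAlg

section Average

variable {n : ℕ}

/-- The unital positive map `a ↦ n⁻¹ ∑ Sᵢ* a Sᵢ`, which on the matrix subalgebras is the normalised
partial trace over the first tensor factor. -/
noncomputable def average (n : ℕ) : CuntzAlgebra n →L[ℂ] CuntzAlgebra n :=
  (n : ℂ)⁻¹ • ∑ i : Fin n, (ContinuousLinearMap.mul ℂ (CuntzAlgebra n)).flip (gen i) ∘L
    ContinuousLinearMap.mul ℂ (CuntzAlgebra n) (star (gen i))

lemma average_apply (a : CuntzAlgebra n) :
    average n a = (n : ℂ)⁻¹ • ∑ i : Fin n, star (gen i) * a * gen i := by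
  simp [average]

lemma average_pow_succ_apply (k : ℕ) (a : CuntzAlgebra n) :
    (average n ^ (k + 1)) a = (average n ^ k) (average n a) := by
  rw [pow_succ, mul_apply_eq_comp]

lemma average_nonneg {a : CuntzAlgebra n} (ha : 0 ≤ a) : 0 ≤ average n a := by
  rw [average_apply]
  exact smul_nonneg (by simp) (Finset.sum_nonneg fun i _ => star_left_conjugate_nonneg ha _)

lemma average_pow_nonneg (k : ℕ) {a : CuntzAlgebra n} (ha : 0 ≤ a) : 0 ≤ (average n ^ k) a := by
  induction k generalizing a with
  | zero => exact ha
  | succ k ih => rw [average_pow_succ_apply]; exact ih (average_nonneg ha)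

lemma average_mem_matrixAlg {k : ℕ} {a : CuntzAlgebra n} (ha : a ∈ matrixAlg n (k + 1)) :
    average n a ∈ matrixAlg n k := by
  rw [average_apply]
  exact SMulMemClass.smul_mem _ (sum_mem fun i _ => ha i i)

lemma average_pow_mem_matrixAlg {k : ℕ} {a : CuntzAlgebra n} (ha : a ∈ matrixAlg n k) :
    (average n ^ k) a ∈ matrixAlg n 0 := by
  induction k generalizing a with
  | zero => exact ha
  | succ k ih => rw [average_pow_succ_apply]; exact ih (average_mem_matrixAlg ha)

lemma average_mul (a b : CuntzAlgebra n) : average n (a * b) =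
    (n : ℂ)⁻¹ • ∑ i : Fin n, ∑ l, (star (gen i) * a * gen l) * (star (gen l) * b * gen i) := by
  simp only [average_apply, star_gen_mul_mul_mul_gen]

lemma average_pow_mul_comm {k : ℕ} {a b : CuntzAlgebra n} (ha : a ∈ matrixAlg n k)
    (hb : b ∈ matrixAlg n k) : (average n ^ k) (a * b) = (average n ^ k) (b * a) := by
  induction k generalizing a b with
  | zero =>
    obtain ⟨c, rfl⟩ := mem_matrixAlg_zero.1 ha
    rw [Algebra.commutes]
  | succ k ih =>
    rw [average_pow_succ_apply, average_pow_succ_apply, average_mul, average_mul, Finset.sum_comm]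
    simp only [map_smul, map_sum]
    exact congrArg _ (Finset.sum_congr rfl fun l _ => Finset.sum_congr rfl fun i _ =>
      ih (ha i l) (hb l i))

variable [NeZero n]

lemma average_algebraMap (c : ℂ) :
    average n (algebraMap ℂ (CuntzAlgebra n) c) = algebraMap ℂ _ c := by
  simp only [average_apply, star_gen_mul_algebraMap_mul_gen, if_true, Finset.sum_const,
    Finset.card_univ, Fintype.card_fin]
  rw [← Nat.cast_smul_eq_nsmul ℂ, smul_smul, inv_mul_cancel₀ (NeZero.ne _), one_smul]

lemma average_pow_algebraMap (k : ℕ) (c : ℂ) :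
    (average n ^ k) (algebraMap ℂ (CuntzAlgebra n) c) = algebraMap ℂ _ c := by
  induction k with
  | zero => rfl
  | succ k ih => rw [average_pow_succ_apply, average_algebraMap, ih]

lemma average_pow_eq_of_le {k m : ℕ} (hkm : k ≤ m) {a : CuntzAlgebra n}
    (ha : a ∈ matrixAlg n k) : (average n ^ m) a = (average n ^ k) a := by
  obtain ⟨c, hc⟩ := mem_matrixAlg_zero.1 (average_pow_mem_matrixAlg ha)
  obtain ⟨d, rfl⟩ := Nat.exists_eq_add_of_le' hkm
  rw [pow_add, mul_apply_eq_comp, ← hc, average_pow_algebraMap]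

lemma norm_gen (i : Fin n) : ‖(gen i : CuntzAlgebra n)‖ = 1 := by
  have h := CStarRing.norm_star_mul_self (x := (gen i : CuntzAlgebra n))
  rw [star_gen_mul_gen, norm_one, ← sq] at h
  exact (pow_eq_one_iff_of_nonneg (norm_nonneg _) two_ne_zero).1 h.symm

lemma norm_average_le : ‖average n‖ ≤ 1 := by
  refine ContinuousLinearMap.opNorm_le_bound _ zero_le_one fun a => ?_
  have hentry : ∀ i : Fin n, ‖star (gen i) * a * gen i‖ ≤ ‖a‖ := fun i => by
    simpa only [norm_star, norm_gen, one_mul, mul_one] using norm_mul₃_le (a := star (gen i))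
      (b := a) (c := gen i)
  rw [average_apply, norm_smul, norm_inv, Complex.norm_natCast, one_mul,
    inv_mul_le_iff₀ (Nat.cast_pos.2 (NeZero.pos n))]
  exact (norm_sum_le_of_le _ fun i _ => hentry i).trans_eq (by simp)

lemma lipschitzWith_average_pow (k : ℕ) : LipschitzWith 1 (average n ^ k) := by
  refine ContinuousLinearMap.lipschitzWith_of_opNorm_le ?_
  exact (norm_pow_le _ k).trans (pow_le_one₀ (norm_nonneg _) norm_average_le)

lemma eq_zero_of_average_eq_zero {a : CuntzAlgebra n} (ha : 0 ≤ a) (h : average n a = 0) :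
    a = 0 := by
  obtain ⟨b, rfl⟩ := CStarAlgebra.nonneg_iff_eq_star_mul_self.1 ha
  have hsum : ∑ i : Fin n, star (b * gen i) * (b * gen i) = 0 := by
    rw [average_apply, smul_eq_zero_iff_right (inv_ne_zero (NeZero.ne _))] at h
    simpa only [star_mul, mul_assoc] using h
  have hb : ∀ i : Fin n, b * gen i = 0 := fun i =>
    (CStarRing.star_mul_self_eq_zero_iff _).1 <| (Finset.sum_eq_zero_iff_of_nonneg fun i _ =>
      star_mul_self_nonneg _).1 hsum i (Finset.mem_univ i)
  have hb0 : b = 0 := by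
    rw [← mul_one b, ← sum_gen_mul_star, Finset.mul_sum]
    exact Finset.sum_eq_zero fun i _ => by rw [← mul_assoc, hb, zero_mul]
  rw [hb0, mul_zero]

lemma eq_zero_of_average_pow_eq_zero {k : ℕ} {a : CuntzAlgebra n} (ha : 0 ≤ a)
    (h : (average n ^ k) a = 0) : a = 0 := by
  induction k generalizing a with
  | zero => exact h
  | succ k ih =>
    rw [average_pow_succ_apply] at h
    exact eq_zero_of_average_eq_zero ha (ih (average_nonneg ha) h)

end Average

section CanonicalTrace

variable {n : ℕ} [NeZero n]

lemma exists_tendsto_average_pow (a : core n) : ∃ c : ℂ, Tendsto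
    (fun m => (average n ^ m) (a : CuntzAlgebra n)) atTop (𝓝 (algebraMap ℂ _ c)) := by
  have hequi : EquicontinuousAt (fun m (a : core n) => (average n ^ m) (a : CuntzAlgebra n)) a :=
    (LipschitzWith.uniformEquicontinuous _ _ fun m =>
      (lipschitzWith_average_pow m).comp (LipschitzWith.subtype_val _)).equicontinuous a
  obtain ⟨y, hy, h⟩ := exists_mem_tendsto_of_equicontinuousAt hequi (dense_iUnion_matrixAlg a)
    (isClosed_matrixAlg 0) fun b hb => by
      obtain ⟨k, hk⟩ := Set.mem_iUnion.1 hb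
      refine ⟨_, average_pow_mem_matrixAlg hk, tendsto_const_nhds.congr' ?_⟩
      filter_upwards [eventually_ge_atTop k] with m hm
      exact (average_pow_eq_of_le hm hk).symm
  obtain ⟨c, rfl⟩ := mem_matrixAlg_zero.1 hy
  exact ⟨c, h⟩

lemma eq_of_tendsto_average_pow {a : CuntzAlgebra n} {c d : ℂ}
    (hc : Tendsto (fun m => (average n ^ m) a) atTop (𝓝 (algebraMap ℂ _ c)))
    (hd : Tendsto (fun m => (average n ^ m) a) atTop (𝓝 (algebraMap ℂ _ d))) : c = d :=
  FaithfulSMul.algebraMap_injective ℂ (CuntzAlgebra n) (tendsto_nhds_unique hc hd)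

/-- The normalised trace of the core: the scalar to which the iterated averages converge. -/
noncomputable def canonicalTrace (n : ℕ) [NeZero n] : core n →ₚ[ℂ] ℂ :=
  PositiveLinearMap.mk₀
    { toFun := fun a => (exists_tendsto_average_pow a).choose
      map_add' := fun a b => by
        refine eq_of_tendsto_average_pow (exists_tendsto_average_pow (a + b)).choose_spec ?_
        rw [map_add]
        exact ((exists_tendsto_average_pow a).choose_spec.add
          (exists_tendsto_average_pow b).choose_spec).congr fun m => (map_add _ _ _).symm
      map_smul' := fun c a => by
        refine eq_of_tendsto_average_pow (exists_tendsto_average_pow (c • a)).choose_spec ?_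
        rw [RingHom.id_apply, smul_eq_mul, map_mul, ← Algebra.smul_def]
        exact ((exists_tendsto_average_pow a).choose_spec.const_smul c).congr fun m =>
          (map_smul _ _ _).symm }
    fun a ha => by
      refine nonneg_of_algebraMap_nonneg (A := CuntzAlgebra n)
        (ge_of_tendsto (exists_tendsto_average_pow a).choose_spec ?_)
      exact Eventually.of_forall fun m => average_pow_nonneg m ha

lemma tendsto_average_pow (a : core n) : Tendsto (fun m => (average n ^ m) (a : CuntzAlgebra n))
    atTop (𝓝 (algebraMap ℂ _ (canonicalTrace n a))) :=
  (exists_tendsto_average_pow a).choose_spec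

lemma algebraMap_canonicalTrace {k : ℕ} {a : core n} (ha : (a : CuntzAlgebra n) ∈ matrixAlg n k) :
    algebraMap ℂ _ (canonicalTrace n a) = (average n ^ k) (a : CuntzAlgebra n) := by
  refine tendsto_nhds_unique (tendsto_average_pow a) (tendsto_const_nhds.congr' ?_)
  filter_upwards [eventually_ge_atTop k] with m hm
  exact (average_pow_eq_of_le hm ha).symm

lemma canonicalTrace_one : canonicalTrace n 1 = 1 := by
  apply FaithfulSMul.algebraMap_injective ℂ (CuntzAlgebra n)
  rw [(algebraMap ℂ (CuntzAlgebra n)).map_one]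
  exact algebraMap_canonicalTrace (k := 0) (one_mem _)

lemma isTracial_canonicalTrace : IsTracial (canonicalTrace n) := by
  have h : (fun p : core n × core n => canonicalTrace n (p.1 * p.2)) =
      fun p => canonicalTrace n (p.2 * p.1) := by
    refine Continuous.ext_on (dense_iUnion_matrixAlg.prod dense_iUnion_matrixAlg)
      ((map_continuous _).comp continuous_mul)
      ((map_continuous _).comp (continuous_snd.mul continuous_fst)) ?_
    rintro ⟨a, b⟩ ⟨ha, hb⟩
    obtain ⟨k, hk⟩ := Set.mem_iUnion.1 ha
    obtain ⟨l, hl⟩ := Set.mem_iUnion.1 hb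
    have ha' : (a : CuntzAlgebra n) ∈ matrixAlg n (max k l) := matrixAlg_mono (le_max_left k l) hk
    have hb' : (b : CuntzAlgebra n) ∈ matrixAlg n (max k l) := matrixAlg_mono (le_max_right k l) hl
    apply FaithfulSMul.algebraMap_injective ℂ (CuntzAlgebra n)
    rw [algebraMap_canonicalTrace (mul_mem ha' hb'), algebraMap_canonicalTrace (mul_mem hb' ha')]
    exact average_pow_mul_comm ha' hb'
  exact fun a b => congrFun h (a, b)

theorem isFaithfulNormalizedTrace_canonicalTrace :
    IsFaithfulNormalizedTrace (canonicalTrace n) where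
  map_one := canonicalTrace_one
  map_mul_comm := isTracial_canonicalTrace
  faithful a ha := by
    refine isTracial_canonicalTrace.faithful_of_dense_iUnion
      (fun k => (isClosed_matrixAlg k).preimage continuous_subtype_val) dense_iUnion_matrixAlg
      (fun k b hb hb0 => ?_) ha
    have h := algebraMap_canonicalTrace (k := k) (a := star b * b) (mul_mem (star_mem hb) hb)
    rw [hb0, map_zero] at h
    exact (CStarRing.star_mul_self_eq_zero_iff b).1 <| Subtype.ext <|
      eq_zero_of_average_pow_eq_zero (star_mul_self_nonneg (b : CuntzAlgebra n)) h.symm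

end CanonicalTrace

section Uniqueness

variable {n : ℕ}

lemma monomial_mul_monomial (μ ν ρ : List (Fin n)) :
    monomial μ ν * monomial ν ρ = monomial μ ρ := by
  rw [monomial_eq, monomial_eq, monomial_eq, mul_assoc, ← mul_assoc (star (word ν)),
    star_word_mul_word, one_mul]

lemma monomial_mul_monomial_of_ne (μ : List (Fin n)) {ν ν' : List (Fin n)} (ρ : List (Fin n))
    (hl : ν.length = ν'.length) (h : ν ≠ ν') : monomial μ ν * monomial ν' ρ = 0 := by
  rw [monomial_eq, monomial_eq, mul_assoc, ← mul_assoc (star (word ν)),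
    star_word_mul_word_of_ne hl h, zero_mul, mul_zero]

lemma sum_monomial_append (μ ν : List (Fin n)) :
    ∑ j : Fin n, monomial (μ ++ [j]) (ν ++ [j]) = monomial μ ν := by
  have h : ∀ j : Fin n, monomial (μ ++ [j]) (ν ++ [j]) =
      word μ * (gen j * star (gen j)) * star (word ν : CuntzAlgebra n) := fun j => by
    simp only [monomial_eq, word_append, word_cons, word_nil, mul_one, star_mul, mul_assoc]
  simp only [h, ← Finset.sum_mul, ← Finset.mul_sum, sum_gen_mul_star, mul_one, monomial_eq]

variable {τ τ' : core n →ₚ[ℂ] ℂ}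

lemma gaugeState_apply (τ : core n →ₚ[ℂ] ℂ) (a : CuntzAlgebra n) :
    gaugeState τ a = τ (expectation n a) := rfl

lemma gaugeState_mul_comm (hτ : IsTracial τ) {f : CuntzAlgebra n} (hf : f ∈ core n)
    (a : CuntzAlgebra n) : gaugeState τ (a * f) = gaugeState τ (f * a) := by
  lift f to core n using hf
  rw [gaugeState_apply, gaugeState_apply, expectation_mul_right, expectation_mul_left, hτ]

lemma gaugeState_monomial_of_ne (hτ : IsTracial τ) {μ ν : List (Fin n)} (h : μ ≠ ν) :
    gaugeState τ (monomial μ ν) = 0 := by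
  by_cases hl : μ.length = ν.length
  · rw [← monomial_mul_monomial μ ν ν, gaugeState_mul_comm hτ (monomial_mem_core rfl),
      monomial_mul_monomial_of_ne _ _ hl.symm h.symm, map_zero]
  · rw [gaugeState_apply, expectation_monomial_of_length_ne hl, map_zero]

lemma gaugeState_monomial_self_congr (hτ : IsTracial τ) {μ ν : List (Fin n)}
    (h : μ.length = ν.length) :
    gaugeState τ (monomial μ μ) = gaugeState τ (monomial ν ν) := by
  rw [← monomial_mul_monomial μ ν μ, gaugeState_mul_comm hτ (monomial_mem_core h.symm),
    monomial_mul_monomial]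

lemma gaugeState_monomial_self [NeZero n] (hτ : IsTracial τ) (h1 : τ 1 = 1) (μ : List (Fin n)) :
    gaugeState τ (monomial μ μ) = ((n : ℂ) ^ μ.length)⁻¹ := by
  induction μ with
  | nil =>
    have hnil : (monomial [] [] : CuntzAlgebra n) = (1 : core n) := by simp [monomial_eq]
    rw [hnil, gaugeState_apply, expectation_coe, h1, List.length_nil, pow_zero, inv_one]
  | cons i μ ih =>
    have hsum : gaugeState τ (monomial μ μ) = n * gaugeState τ (monomial (i :: μ) (i :: μ)) := by
      rw [← sum_monomial_append, map_sum, Finset.sum_congr rfl fun j _ =>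
        gaugeState_monomial_self_congr hτ (show (μ ++ [j]).length = (i :: μ).length by simp)]
      simp
    rw [List.length_cons, pow_succ, mul_inv, ← ih, hsum]
    field_simp [NeZero.ne n]

theorem eq_of_isTracial [NeZero n] (hτ : IsTracial τ) (h1 : τ 1 = 1) (hτ' : IsTracial τ')
    (h1' : τ' 1 = 1) : τ = τ' := by
  have hspan : ∀ a ∈ algSpan n, gaugeState τ a = gaugeState τ' a := by
    intro a ha
    induction ha using Submodule.span_induction with
    | mem a ha =>
      obtain ⟨μ, ν, rfl⟩ := ha
      obtain rfl | h := eq_or_ne μ ν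
      · rw [gaugeState_monomial_self hτ h1, gaugeState_monomial_self hτ' h1']
      · rw [gaugeState_monomial_of_ne hτ h, gaugeState_monomial_of_ne hτ' h]
    | zero => rw [map_zero, map_zero]
    | add a b _ _ ha hb => rw [map_add, map_add, ha, hb]
    | smul c a _ ha => rw [map_smul, map_smul, ha]
  refine DFunLike.coe_injective <|
    Continuous.ext_on dense_expectation_algSpan (map_continuous τ) (map_continuous τ') ?_
  rintro _ ⟨a, ha, rfl⟩
  exact hspan a ha

end Uniqueness

section HilbertSpace

variable {n : ℕ} {τ : core n →ₚ[ℂ] ℂ}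

lemma norm_toL2_sq (a : CuntzAlgebra n) :
    ((‖toL2 τ a‖ ^ 2 : ℝ) : ℂ) = gaugeState τ (star a * a) := by
  rw [← inner_toL2, inner_self_eq_norm_sq_to_K]
  norm_cast

lemma denseRange_toL2 : DenseRange (toL2 τ) :=
  (UniformSpace.Completion.denseRange_coe (α := (gaugeState τ).PreGNS)).comp
    (gaugeState τ).toPreGNS.surjective.denseRange (UniformSpace.Completion.continuous_coe _)

lemma continuous_toL2 : Continuous (toL2 τ) := by
  have h : ⇑(toL2 τ) = fun a => leftMul τ a (toL2 τ 1) := by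
    ext a
    rw [leftMul_toL2, mul_one]
  rw [h]
  exact (map_continuous (leftMul τ)).clm_apply continuous_const

lemma dense_span_monomial :
    Dense (Submodule.span ℂ (Set.range fun p : List (Fin n) × List (Fin n) =>
      toL2 τ (monomial p.1 p.2)) : Set (L2 τ)) := by
  refine (denseRange_toL2.dense_image continuous_toL2 dense_algSpan).mono ?_
  rintro _ ⟨a, ha, rfl⟩
  refine (algSpan n).map_le_iff_le_comap.2 (Submodule.span_le.2 ?_) ⟨a, ha, rfl⟩
  rintro _ ⟨μ, ν, rfl⟩
  exact Submodule.subset_span ⟨(μ, ν), rfl⟩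

lemma ext_toL2 {S T : L2 τ →L[ℂ] L2 τ} (h : ∀ a, S (toL2 τ a) = T (toL2 τ a)) : S = T :=
  DFunLike.coe_injective (denseRange_toL2.equalizer S.continuous T.continuous (funext h))

variable (τ) in
/-- The projection of `L²(O_n)` onto the closure of `F`, which extends `Φ`. -/
noncomputable abbrev coreProj : L2 τ →L[ℂ] L2 τ := (coreL2 τ).starProjection

lemma rankOneEnd_eq (x y : CuntzAlgebra n) :
    rankOneEnd τ x y = leftMul τ x * coreProj τ * leftMul τ (star y) := rfl

lemma isStarProjection_coreProj : IsStarProjection (coreProj τ) := isStarProjection_starProjection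

lemma coreProj_toL2_coe (f : core n) : coreProj τ (toL2 τ f) = toL2 τ f := by
  rw [starProjection_toL2, expectation_coe]

end HilbertSpace

section RightMul

variable {n : ℕ} {τ : core n →ₚ[ℂ] ℂ}

lemma norm_toL2_mul_le (hτ : IsTracial τ) (a : CuntzAlgebra n) (f : core n) :
    ‖toL2 τ (a * f)‖ ≤ ‖f‖ * ‖toL2 τ a‖ := by
  have hexp : expectation n (star (a * f) * (a * f)) =
      star f * expectation n (star a * a) * f := by
    rw [← expectation_mul_left, ← expectation_mul_right]
    simp only [star_mul, mul_assoc, StarMemClass.coe_star]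
  have hle := hτ.apply_star_mul_mul_le
    ((expectation n).map_nonneg (star_mul_self_nonneg a)) f
  rw [← hexp, ← gaugeState_apply, ← gaugeState_apply, ← norm_toL2_sq, ← norm_toL2_sq,
    ← Complex.ofReal_mul, Complex.real_le_real, ← mul_pow] at hle
  exact (sq_le_sq₀ (norm_nonneg _) (by positivity)).1 hle

/-- Right multiplication by an element `f` of the core; it is bounded on `L²(O_n)` because `τ` is a
trace. -/
noncomputable def rightMul (hτ : IsTracial τ) (f : core n) : L2 τ →L[ℂ] L2 τ :=
  (((gaugeState τ).toPreGNS.toLinearMap ∘ₗ LinearMap.mulRight ℂ (f : CuntzAlgebra n) ∘ₗ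
    (gaugeState τ).ofPreGNS.toLinearMap).mkContinuous ‖f‖ fun x => by
      have h := norm_toL2_mul_le hτ ((gaugeState τ).ofPreGNS x) f
      have hnorm : ∀ b, ‖toL2 τ b‖ = ‖(gaugeState τ).toPreGNS b‖ := fun b =>
        UniformSpace.Completion.norm_coe _
      rwa [hnorm, hnorm] at h).completion

lemma rightMul_toL2 (hτ : IsTracial τ) (f : core n) (a : CuntzAlgebra n) :
    rightMul hτ f (toL2 τ a) = toL2 τ (a * f) :=
  ContinuousLinearMap.completion_apply_coe _ _

lemma commute_rightMul_leftMul (hτ : IsTracial τ) (f : core n) (x : CuntzAlgebra n) :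
    Commute (rightMul hτ f) (leftMul τ x) := ext_toL2 fun a => by
  rw [mul_apply_eq_comp, mul_apply_eq_comp, leftMul_toL2, rightMul_toL2, rightMul_toL2,
    leftMul_toL2, mul_assoc]

lemma commute_rightMul_coreProj (hτ : IsTracial τ) (f : core n) :
    Commute (rightMul hτ f) (coreProj τ) := ext_toL2 fun a => by
  rw [mul_apply_eq_comp, mul_apply_eq_comp, starProjection_toL2, rightMul_toL2, rightMul_toL2,
    starProjection_toL2, expectation_mul_right, MulMemClass.coe_mul]

lemma rankOneEnd_mem_endVN {x y : CuntzAlgebra n} (hx : x ∈ algSpan n) (hy : y ∈ algSpan n) :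
    rankOneEnd τ x y ∈ endVN τ :=
  Set.subset_centralizer_centralizer (Submodule.subset_span ⟨x, hx, y, hy, rfl⟩)

lemma commute_rightMul (hτ : IsTracial τ) (f : core n) {T : L2 τ →L[ℂ] L2 τ}
    (hT : T ∈ endVN τ) : Commute (rightMul hτ f) T := by
  refine hT (rightMul hτ f) fun S hS => Commute.symm (show Commute (rightMul hτ f) S from ?_)
  induction hS using Submodule.span_induction with
  | mem S hS =>
    obtain ⟨x, -, y, -, rfl⟩ := hS
    exact ((commute_rightMul_leftMul hτ f x).mul_right
      (commute_rightMul_coreProj hτ f)).mul_right (commute_rightMul_leftMul hτ f (star y))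
  | zero => exact Commute.zero_right _
  | add S S' _ _ h h' => exact h.add_right h'
  | smul c S _ h => exact h.smul_right c

end RightMul

section CoreInner

variable {n : ℕ} {τ : core n →ₚ[ℂ] ℂ}

variable (τ) in
/-- The `F`-valued inner product `z ↦ (y|z)_R = Φ(y* z)`, extended to `L²(O_n)`. -/
noncomputable def coreInner (y : CuntzAlgebra n) : L2 τ →L[ℂ] L2 τ :=
  coreProj τ * leftMul τ (star y)

lemma star_coreInner (y : CuntzAlgebra n) :
    star (coreInner τ y) = leftMul τ y * coreProj τ := by
  rw [coreInner, star_mul, isStarProjection_coreProj.isSelfAdjoint.star_eq, ← map_star, star_star]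

lemma star_coreInner_mul_coreInner (x y : CuntzAlgebra n) :
    star (coreInner τ x) * coreInner τ y = rankOneEnd τ x y := by
  rw [star_coreInner, coreInner, mul_assoc, ← mul_assoc (coreProj τ),
    isStarProjection_coreProj.isIdempotentElem.eq, rankOneEnd_eq, mul_assoc]

lemma star_coreInner_toL2_one (y : CuntzAlgebra n) :
    star (coreInner τ y) (toL2 τ 1) = toL2 τ y := by
  have hone : coreProj τ (toL2 τ 1) = toL2 τ 1 := coreProj_toL2_coe 1
  rw [star_coreInner, mul_apply_eq_comp, hone, leftMul_toL2, mul_one]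

lemma rankOneEnd_self_nonneg (x : CuntzAlgebra n) : 0 ≤ rankOneEnd τ x x := by
  rw [← star_coreInner_mul_coreInner]
  exact star_mul_self_nonneg _

lemma rankOneEnd_mul_rankOneEnd (w x y z : CuntzAlgebra n) :
    rankOneEnd τ w x * rankOneEnd τ y z =
      rankOneEnd τ (w * (expectation n (star x * y) : CuntzAlgebra n)) z := by
  refine ext_toL2 fun a => ?_
  rw [mul_apply_eq_comp, rankOneEnd_toL2, rankOneEnd_toL2, rankOneEnd_toL2, ← mul_assoc (star x),
    expectation_mul_right, MulMemClass.coe_mul, mul_assoc]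

lemma isStarProjection_rankOneEnd_self {x : CuntzAlgebra n}
    (hx : x * (expectation n (star x * x) : CuntzAlgebra n) = x) :
    IsStarProjection (rankOneEnd τ x x) where
  isIdempotentElem := by rw [IsIdempotentElem, rankOneEnd_mul_rankOneEnd, hx]
  isSelfAdjoint := star_rankOneEnd τ x x

lemma rankOneEnd_mul_rankOneEnd_eq_zero {w x y z : CuntzAlgebra n}
    (h : expectation n (star x * y) = 0) : rankOneEnd τ w x * rankOneEnd τ y z = 0 := by
  rw [rankOneEnd_mul_rankOneEnd, h, ZeroMemClass.coe_zero, mul_zero, rankOneEnd_eq, map_zero,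
    zero_mul, zero_mul]

lemma commute_rightMul_coreInner (hτ : IsTracial τ) (f : core n) (y : CuntzAlgebra n) :
    Commute (rightMul hτ f) (coreInner τ y) :=
  (commute_rightMul_coreProj hτ f).mul_right (commute_rightMul_leftMul hτ f (star y))

lemma commute_rightMul_star_coreInner (hτ : IsTracial τ) (f : core n) (y : CuntzAlgebra n) :
    Commute (rightMul hτ f) (star (coreInner τ y)) := by
  rw [star_coreInner]
  exact (commute_rightMul_leftMul hτ f y).mul_right (commute_rightMul_coreProj hτ f)

lemma rankOneEnd_polarization (x y : CuntzAlgebra n) :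
    (4 : ℂ) • rankOneEnd τ x y = rankOneEnd τ (x + y) (x + y) - rankOneEnd τ (x - y) (x - y) +
      Complex.I • rankOneEnd τ (x + Complex.I • y) (x + Complex.I • y) -
      Complex.I • rankOneEnd τ (x - Complex.I • y) (x - Complex.I • y) := by
  simp only [rankOneEnd_eq, star_add, star_sub, star_smul, map_add, map_sub, map_smul, mul_add,
    add_mul, mul_sub, sub_mul, smul_mul_assoc, mul_smul_comm, smul_add, smul_sub, smul_smul,
    Complex.star_def, Complex.conj_I]
  simp only [mul_neg, Complex.I_mul_I, neg_neg, one_smul, neg_smul]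
  module

end CoreInner

section VectorState

variable {n : ℕ} {τ : core n →ₚ[ℂ] ℂ}

lemma star_rightMul (hτ : IsTracial τ) (f : core n) :
    star (rightMul hτ f) = rightMul hτ (star f) := by
  rw [ContinuousLinearMap.star_eq_adjoint, eq_comm, ContinuousLinearMap.eq_adjoint_iff]
  refine denseRange_toL2.induction_on₂ (isClosed_eq (by fun_prop) (by fun_prop)) fun a b => ?_
  rw [rightMul_toL2, rightMul_toL2, inner_toL2, inner_toL2, StarMemClass.coe_star, star_mul,
    star_star, mul_assoc, ← gaugeState_mul_comm hτ f.2, mul_assoc]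

lemma norm_toL2_star (hτ : IsTracial τ) (f : core n) :
    ‖toL2 τ (star (f : CuntzAlgebra n))‖ = ‖toL2 τ f‖ := by
  refine (sq_eq_sq₀ (norm_nonneg _) (norm_nonneg _)).1 (Complex.ofReal_injective ?_)
  rw [norm_toL2_sq, norm_toL2_sq, star_star, gaugeState_mul_comm hτ f.2]

-- `⟨A* 1, f⟩ = ⟨1, A R_f 1⟩ = ⟨R_f* 1, A 1⟩ = ⟨f*, A 1⟩`
lemma inner_star_apply_one (hτ : IsTracial τ) {A : L2 τ →L[ℂ] L2 τ}
    (hA : ∀ f, Commute (rightMul hτ f) A) (f : core n) :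
    ⟪star A (toL2 τ 1), toL2 τ f⟫_ℂ = ⟪toL2 τ (star f : core n), A (toL2 τ 1)⟫_ℂ := by
  have hright : ∀ g : core n, rightMul hτ g (toL2 τ 1) = toL2 τ g := fun g => by
    rw [rightMul_toL2, one_mul]
  rw [ContinuousLinearMap.star_eq_adjoint, ContinuousLinearMap.adjoint_inner_left, ← hright f,
    ← mul_apply_eq_comp, ← (hA f).eq, mul_apply_eq_comp, ← hright (star f), ← star_rightMul,
    ContinuousLinearMap.star_eq_adjoint, ContinuousLinearMap.adjoint_inner_left]

lemma norm_inner_star_apply_one_le (hτ : IsTracial τ) {A : L2 τ →L[ℂ] L2 τ}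
    (hA : ∀ f, Commute (rightMul hτ f) A) {v : L2 τ} (hv : v ∈ coreL2 τ) :
    ‖⟪star A (toL2 τ 1), v⟫_ℂ‖ ≤ ‖A (toL2 τ 1)‖ * ‖v‖ := by
  refine closure_minimal (t := {v | ‖⟪star A (toL2 τ 1), v⟫_ℂ‖ ≤ ‖A (toL2 τ 1)‖ * ‖v‖})
    ?_ (isClosed_le (by fun_prop) (by fun_prop)) hv
  rintro _ ⟨f, hf, rfl⟩
  lift f to core n using hf
  rw [Set.mem_ofPred_eq, inner_star_apply_one hτ hA, ← norm_toL2_star hτ, mul_comm]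
  exact norm_inner_le_norm _ _

lemma norm_star_apply_one_le (hτ : IsTracial τ) {A : L2 τ →L[ℂ] L2 τ}
    (hA : ∀ f, Commute (rightMul hτ f) A) (hmem : star A (toL2 τ 1) ∈ coreL2 τ) :
    ‖star A (toL2 τ 1)‖ ≤ ‖A (toL2 τ 1)‖ := by
  have h := norm_inner_star_apply_one_le hτ hA hmem
  rw [inner_self_eq_norm_sq_to_K, ← RCLike.ofReal_pow, RCLike.norm_ofReal,
    abs_of_nonneg (sq_nonneg _), sq] at h
  obtain hzero | hpos := (norm_nonneg (star A (toL2 τ 1))).eq_or_lt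
  · exact hzero ▸ norm_nonneg _
  · exact le_of_mul_le_mul_right h hpos

-- The vector functional of `1` is a trace on right `F`-linear operators; apply this to
-- `A = (y|·)_R T x`.
lemma norm_coreInner_star_apply_le (hτ : IsTracial τ) {T : L2 τ →L[ℂ] L2 τ} (hT : T ∈ endVN τ)
    (x y : CuntzAlgebra n) :
    ‖coreInner τ x (star T (toL2 τ y))‖ ≤ ‖coreInner τ y (T (toL2 τ x))‖ := by
  have hA : ∀ f, Commute (rightMul hτ f) (coreInner τ y * (T * star (coreInner τ x))) := fun f =>
    (commute_rightMul_coreInner hτ f y).mul_right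
      ((commute_rightMul hτ f hT).mul_right (commute_rightMul_star_coreInner hτ f x))
  have hstar : star (coreInner τ y * (T * star (coreInner τ x))) (toL2 τ 1) =
      coreInner τ x (star T (toL2 τ y)) := by
    rw [star_mul, star_mul, star_star, mul_apply_eq_comp, mul_apply_eq_comp,
      star_coreInner_toL2_one]
  have hmem : coreInner τ x (star T (toL2 τ y)) ∈ coreL2 τ :=
    Submodule.starProjection_apply_mem _ _
  have h := norm_star_apply_one_le hτ hA (hstar ▸ hmem)
  rwa [hstar, mul_apply_eq_comp, mul_apply_eq_comp, star_coreInner_toL2_one] at h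

end VectorState

section Frame

/-- The index set of the frame: `inl μ` stands for `S_μ`, and `inr k` for `(S₁*)^(k + 1)`. -/
abbrev FrameIndex (n : ℕ) : Type := List (Fin n) ⊕ ℕ

variable {n : ℕ}

/-- The gauge degree of a frame element. -/
def frameDegree : FrameIndex n → ℤ
  | .inl μ => μ.length
  | .inr k => -(k + 1)

variable [NeZero n]

/-- A frame of the module `X_c` over `F`: all `S_μ`, together with the powers of `S₁*`, which
reach the negative degrees. The generator `S₁` is the one with index `0 : Fin n`. -/
noncomputable def frame : FrameIndex n → CuntzAlgebra n
  | .inl μ => word μ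
  | .inr k => star (word (List.replicate (k + 1) 0))

lemma frame_mem_algSpan (i : FrameIndex n) : frame i ∈ algSpan n := by
  cases i with
  | inl μ => exact word_mem_algSpan μ
  | inr k => exact star_word_mem_algSpan _

lemma isHomogeneous_frame (i : FrameIndex n) : IsHomogeneous (frameDegree i) (frame i) := by
  cases i with
  | inl μ => exact isHomogeneous_word μ
  | inr k =>
    have h := (isHomogeneous_word (List.replicate (k + 1) (0 : Fin n))).star
    rwa [List.length_replicate, Nat.cast_succ] at h

lemma frame_mul_expectation_star_mul_self (i : FrameIndex n) :
    frame i * (expectation n (star (frame i) * frame i) : CuntzAlgebra n) = frame i := by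
  cases i with
  | inl μ =>
    have hone : (expectation n 1 : CuntzAlgebra n) = 1 := congrArg _ (expectation_coe 1)
    rw [frame, star_word_mul_word, hone, mul_one]
  | inr k =>
    rw [frame, star_star, ← monomial_eq, expectation_monomial_of_length_eq rfl, Subtype.coe_mk,
      monomial_eq, ← mul_assoc, star_word_mul_word, one_mul]

lemma expectation_star_frame_mul_frame {i j : FrameIndex n} (h : i ≠ j) :
    expectation n (star (frame i) * frame j) = 0 := by
  by_cases hd : frameDegree i = frameDegree j
  · match i, j with
    | .inl μ, .inl ν =>
      have hlength : μ.length = ν.length := Nat.cast_inj.1 hd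
      rw [frame, frame, star_word_mul_word_of_ne hlength fun hμν => h (by rw [hμν]), map_zero]
    | .inl μ, .inr k => simp only [frameDegree] at hd; omega
    | .inr k, .inl ν => simp only [frameDegree] at hd; omega
    | .inr k, .inr l => exact absurd (by simp only [frameDegree] at hd; congr 1; omega) h
  · exact ((isHomogeneous_frame i).star.mul (isHomogeneous_frame j)).expectation_eq_zero (by omega)

lemma exists_frame_reproduces_of_le {μ ν : List (Fin n)} (h : ν.length ≤ μ.length) :
    ∃ i : FrameIndex n, frameDegree i = (μ.length : ℤ) - ν.length ∧
      frame i * (expectation n (star (frame i) * monomial μ ν) : CuntzAlgebra n) =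
        monomial μ ν := by
  obtain ⟨α, β, rfl, hβ⟩ : ∃ α β, μ = α ++ β ∧ β.length = ν.length :=
    ⟨_, _, (List.take_append_drop (μ.length - ν.length) μ).symm, by
      rw [List.length_drop, Nat.sub_sub_self h]⟩
  have hcancel : star (word α) * monomial (α ++ β) ν = monomial β ν := by
    rw [monomial_eq, monomial_eq, word_append, ← mul_assoc, ← mul_assoc, star_word_mul_word,
      one_mul]
  refine ⟨.inl α, ?_, ?_⟩
  · rw [frameDegree, List.length_append, hβ, Nat.cast_add, add_sub_cancel_right]
  · rw [frame, hcancel, expectation_monomial_of_length_eq hβ, Subtype.coe_mk, monomial_eq,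
      monomial_eq, word_append, mul_assoc]

lemma exists_frame_reproduces_of_lt {μ ν : List (Fin n)} (h : μ.length < ν.length) :
    ∃ i : FrameIndex n, frameDegree i = (μ.length : ℤ) - ν.length ∧
      frame i * (expectation n (star (frame i) * monomial μ ν) : CuntzAlgebra n) =
        monomial μ ν := by
  obtain ⟨k, hk⟩ : ∃ k, ν.length = k + 1 + μ.length := ⟨ν.length - μ.length - 1, by omega⟩
  have hmul : word (List.replicate (k + 1) 0) * monomial μ ν =
      monomial (List.replicate (k + 1) 0 ++ μ) ν := by
    rw [monomial_eq, monomial_eq, word_append, mul_assoc]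
  refine ⟨.inr k, ?_, ?_⟩
  · rw [frameDegree, hk]
    push_cast
    ring
  · rw [frame, star_star, hmul, expectation_monomial_of_length_eq (by
      rw [List.length_append, List.length_replicate, hk]), Subtype.coe_mk, ← hmul, ← mul_assoc,
      star_word_mul_word, one_mul]

lemma exists_frame_reproduces (μ ν : List (Fin n)) :
    ∃ i : FrameIndex n, frameDegree i = (μ.length : ℤ) - ν.length ∧
      frame i * (expectation n (star (frame i) * monomial μ ν) : CuntzAlgebra n) =
        monomial μ ν :=
  (le_or_gt ν.length μ.length).elim exists_frame_reproduces_of_le exists_frame_reproduces_of_lt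

variable (τ : core n →ₚ[ℂ] ℂ)

/-- The projection of `L²(O_n)` onto the submodule generated by a frame element. -/
noncomputable def frameProj (i : FrameIndex n) : L2 τ →L[ℂ] L2 τ :=
  rankOneEnd τ (frame i) (frame i)

lemma frameProj_mem_endVN (i : FrameIndex n) : frameProj τ i ∈ endVN τ :=
  rankOneEnd_mem_endVN (frame_mem_algSpan i) (frame_mem_algSpan i)

lemma exists_frameProj_fixes (μ ν : List (Fin n)) :
    ∃ i : FrameIndex n, frameDegree i = (μ.length : ℤ) - ν.length ∧
      frameProj τ i (toL2 τ (monomial μ ν)) = toL2 τ (monomial μ ν) := by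
  obtain ⟨i, hdegree, hi⟩ := exists_frame_reproduces μ ν
  exact ⟨i, hdegree, by rw [frameProj, rankOneEnd_toL2, hi]⟩

theorem isResolutionOfIdentity_frameProj : IsResolutionOfIdentity (frameProj τ) := by
  refine .of_dense_span
    (fun i => isStarProjection_rankOneEnd_self (frame_mul_expectation_star_mul_self i))
    (fun i j h => rankOneEnd_mul_rankOneEnd_eq_zero (expectation_star_frame_mul_frame h))
    dense_span_monomial ?_
  rintro _ ⟨p, rfl⟩
  obtain ⟨i, -, hi⟩ := exists_frameProj_fixes τ p.1 p.2
  exact ⟨i, hi⟩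

theorem gaugeGenerator_eq_diagonal :
    gaugeGenerator τ =
      (diagonalGraph (frameProj τ) fun i => (frameDegree i : ℂ)).toLinearPMap := by
  choose k hdegree hfix using fun p : List (Fin n) × List (Fin n) =>
    exists_frameProj_fixes τ p.1 p.2
  rw [← topologicalClosure_span_eq_diagonalGraph (isResolutionOfIdentity_frameProj τ) hfix
    dense_span_monomial, gaugeGenerator]
  congr 3
  ext p
  simp [Prod.exists, hdegree, eq_comm]

end Frame

section FrameTrace

variable {n : ℕ} [NeZero n] {τ : core n →ₚ[ℂ] ℂ}

variable (τ) in
/-- The weight `T ↦ ∑ ⟨T ξ, ξ⟩` on `B(L²(O_n))`, the sum being over the frame. -/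
noncomputable def frameTrace : (L2 τ →L[ℂ] L2 τ) → ℝ≥0∞ :=
  vectorWeight fun i => toL2 τ (frame i)

lemma frameTrace_star_mul_self (T : L2 τ →L[ℂ] L2 τ) :
    frameTrace τ (star T * T) =
      ∑' i, ∑' j, ENNReal.ofReal (‖coreInner τ (frame j) (T (toL2 τ (frame i)))‖ ^ 2) := by
  rw [frameTrace, vectorWeight_star_mul_self]
  exact tsum_congr fun i => ((isResolutionOfIdentity_frameProj τ).tsum_ofReal_norm_sq
    (fun j => star_coreInner_mul_coreInner (frame j) (frame j)) _).symm

lemma frameTrace_mul_star_self_le (hτ : IsTracial τ) {T : L2 τ →L[ℂ] L2 τ} (hT : T ∈ endVN τ) :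
    frameTrace τ (T * star T) ≤ frameTrace τ (star T * T) := by
  have hstar := frameTrace_star_mul_self (star T)
  rw [star_star] at hstar
  rw [hstar, frameTrace_star_mul_self, ENNReal.tsum_comm]
  gcongr with i j
  exact norm_coreInner_star_apply_le hτ hT _ _

lemma frameTrace_star_mul_self_eq (hτ : IsTracial τ) {T : L2 τ →L[ℂ] L2 τ} (hT : T ∈ endVN τ) :
    frameTrace τ (star T * T) = frameTrace τ (T * star T) := by
  refine le_antisymm ?_ (frameTrace_mul_star_self_le hτ hT)
  have h := frameTrace_mul_star_self_le hτ (star_mem hT)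
  rwa [star_star] at h

lemma eq_zero_of_forall_apply_frame_eq_zero (hτ : IsTracial τ) {T : L2 τ →L[ℂ] L2 τ}
    (hT : T ∈ endVN τ) (h : ∀ i, T (toL2 τ (frame i)) = 0) : T = 0 := by
  refine ContinuousLinearMap.ext_on dense_span_monomial ?_
  rintro _ ⟨⟨μ, ν⟩, rfl⟩
  obtain ⟨i, -, hi⟩ := exists_frame_reproduces μ ν
  dsimp only
  rw [← hi, ← rightMul_toL2 hτ, ← mul_apply_eq_comp, ← (commute_rightMul hτ _ hT).eq,
    mul_apply_eq_comp, h, map_zero, zero_apply]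

lemma hasSum_inner_rankOneEnd (hτ : IsTracial τ) (x y : CuntzAlgebra n) :
    HasSum (fun i => ⟪toL2 τ (frame i), rankOneEnd τ x y (toL2 τ (frame i))⟫_ℂ)
      (gaugeState τ (star y * x)) := by
  have hcoeff : ∀ i, ⟪toL2 τ (frame i), rankOneEnd τ x y (toL2 τ (frame i))⟫_ℂ =
      ⟪toL2 τ y, frameProj τ i (toL2 τ x)⟫_ℂ := fun i => by
    rw [frameProj, rankOneEnd_toL2, rankOneEnd_toL2, inner_toL2, inner_toL2, ← mul_assoc,
      ← mul_assoc, gaugeState_apply, gaugeState_apply, expectation_mul_right,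
      expectation_mul_right, hτ]
  have hsum := ((isResolutionOfIdentity_frameProj τ).hasSum (toL2 τ x)).mapL (innerSL ℂ (toL2 τ y))
  simpa only [innerSL_apply_apply, inner_toL2, hcoeff] using hsum

lemma frameTrace_rankOneEnd_self_lt_top (hτ : IsTracial τ) (x : CuntzAlgebra n) :
    frameTrace τ (rankOneEnd τ x x) < ∞ :=
  vectorWeight_lt_top_of_summable _ (rankOneEnd_self_nonneg x)
    (hasSum_inner_rankOneEnd hτ x x).summable

lemma rankOneEnd_mem_traceDomain (hτ : IsTracial τ) {x y : CuntzAlgebra n} (hx : x ∈ algSpan n)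
    (hy : y ∈ algSpan n) : rankOneEnd τ x y ∈ (endVN τ).traceDomain (frameTrace τ) := by
  have hself : ∀ z ∈ algSpan n, rankOneEnd τ z z ∈ (endVN τ).traceDomain (frameTrace τ) :=
    fun z hz => Submodule.subset_span ⟨rankOneEnd_mem_endVN hz hz, rankOneEnd_self_nonneg z,
      frameTrace_rankOneEnd_self_lt_top hτ z⟩
  have hI := Submodule.smul_mem _ Complex.I hy
  rw [← Submodule.smul_mem_iff _ (four_ne_zero (α := ℂ)), rankOneEnd_polarization]
  exact sub_mem (add_mem (sub_mem (hself _ (add_mem hx hy)) (hself _ (sub_mem hx hy)))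
    (Submodule.smul_mem _ _ (hself _ (add_mem hx hI))))
    (Submodule.smul_mem _ _ (hself _ (sub_mem hx hI)))

theorem isFNSTrace_frameTrace (hτ : IsTracial τ) : (endVN τ).IsFNSTrace (frameTrace τ) :=
  isFNSTrace_vectorWeight _ (fun _ hT => frameTrace_star_mul_self_eq hτ hT)
    (fun _ hT h => eq_zero_of_forall_apply_frame_eq_zero hτ hT h)
    (isResolutionOfIdentity_frameProj τ) (frameProj_mem_endVN τ)
    fun i => frameTrace_rankOneEnd_self_lt_top hτ (frame i)

end FrameTrace

end CuntzAlgebra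

theorem proposition8p4 (n : ℕ) (hn : 2 ≤ n) :
    -- `τ` is the unique faithful normalised trace on the fixed point algebra `F`
    ∃ τ : core n →ₚ[ℂ] ℂ, IsFaithfulNormalizedTrace τ ∧
      (∀ τ' : core n →ₚ[ℂ] ℂ, IsFaithfulNormalizedTrace τ' → τ' = τ) ∧
      (endVN τ).IsSemifinite ∧
      (∃ τt : (L2 τ →L[ℂ] L2 τ) → ℝ≥0∞, (endVN τ).IsFNSTrace τt ∧
        -- `t` is the linear extension of the trace `τt` to its domain of definition
        ∃ t : (endVN τ).traceDomain τt →ₗ[ℂ] ℂ,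
          (∀ (T : L2 τ →L[ℂ] L2 τ) (hT : T ∈ endVN τ ∧ 0 ≤ T ∧ τt T < ∞),
            t ⟨T, Submodule.subset_span hT⟩ = ((τt T).toReal : ℂ)) ∧
          ∀ x ∈ algSpan n, ∀ y ∈ algSpan n,
            ∃ h : rankOneEnd τ x y ∈ (endVN τ).traceDomain τt,
              t ⟨rankOneEnd τ x y, h⟩ = gaugeState τ (star y * x)) ∧
      (endVN τ).IsAffiliated (gaugeGenerator τ) := by
  have : NeZero n := ⟨by omega⟩
  have hτ := isTracial_canonicalTrace (n := n)
  set τ := canonicalTrace n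
  have hq := isResolutionOfIdentity_frameProj τ
  have hqN := frameProj_mem_endVN τ
  have hFNS := isFNSTrace_frameTrace hτ
  have hfin i := frameTrace_rankOneEnd_self_lt_top hτ (frame i)
  obtain ⟨t, ht⟩ := exists_linearMap_hasSum_inner (fun i => toL2 τ (frame i)) (endVN τ)
  refine ⟨τ, isFaithfulNormalizedTrace_canonicalTrace, fun τ' hτ' => ?_,
    isSemifinite_of_trace_lt_top hFNS hq hqN hfin,
    ⟨frameTrace τ, hFNS, t, fun T hT => ?_, fun x hx y hy => ?_⟩, ?_⟩
  · exact eq_of_isTracial hτ'.map_mul_comm hτ'.map_one hτ canonicalTrace_one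
  · exact (ht ⟨T, Submodule.subset_span hT⟩).unique
      (hasSum_inner_of_vectorWeight_lt_top _ hT.2.1 hT.2.2)
  · have hxy := rankOneEnd_mem_traceDomain hτ hx hy
    exact ⟨hxy, (ht ⟨_, hxy⟩).unique (hasSum_inner_rankOneEnd hτ x y)⟩
  · rw [gaugeGenerator_eq_diagonal]
    exact isAffiliated_diagonal hq hqN
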